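/- Let $e_j(x)=x^j$ for $j=0,1,2$ and let $E$ be $C([0,1])$ (real continuous functions, supremum norm $\|\cdot\|_\infty$, pointwise order) or $L_1([0,1])$ (real functions, Lebesgue measure, norm $\|\cdot\|_1$, almost everywhere order). An operator $T:E\to E$ (not assumed linear) is called sublinear if $T(f+g)\le T(f)+T(g)$ and $T(\alpha f)=\alpha T(f)$ for all $f,g\in E$ and $\alpha\ge 0$; monotone if $f\le g$ implies $T(f)\le T(g)$; and strongly translatable if $T(f+\alpha e_0)=T(f)+\alpha T(e_0)$ for all $f\in E$ and $\alpha\in\mathbb{R}$. Its norm is $\|T\|=\inf\{c>0:\ \|T(f)\|\le c\|f\|\text{ for all }f\in E\}$ (finite for every sublinear monotone $T$). With $p=\infty$ if $E=C([0,1])$ and $p=1$ if $E=L_1([0,1])$, put $$\lambda_p=\max\{\|T(e_0)-e_0\|_p,\ \|T(e_1)-e_1\|_p,\ \|T(-e_1)+e_1\|_p,\ \|T(e_2)-e_2\|_p\}.$$ For $r\in\mathbb{N}$ and $\delta\ge 0$ let $$\omega_{r,p}(f;\delta)=\sup_{|h|\le\delta}\Big\|\sum_{j=0}^{r}(-1)^j\binom{r}{j}f(\cdot+(r-j)h)\Big\|_{L_p(\{x:\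 x,\,x+rh\in[0,1]\})}.$$ (i) There is a function $C:\mathbb{R}\to(0,\infty)$ such that for every sublinear, monotone and strongly translatable operator $T:C([0,1])\to C([0,1])$ and every $f\in C([0,1])$, $$\|f-T(f)\|_\infty\le C(\|T\|)\,\big\{\|f\|_\infty\,\lambda_\infty+\omega_{2,\infty}(f;\lambda_\infty^{1/2})\big\}.$$ (ii) There is a function $C:\mathbb{R}\to(0,\infty)$ such that for every sublinear, monotone and strongly translatable operator $T:L_1([0,1])\to L_1([0,1])$ and every $f\in L_1([0,1])$, $$\|f-T(f)\|_1\le C(\|T\|)\,\big\{\|f\|_1\,\lambda_1+\omega_{3,1}(f;\lambda_1^{1/3})\big\}.$$ -/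

import Mathlib

open MeasureTheory
open scoped ENNReal

namespace Korovkin

/-! ### Classes of operators on an ordered normed space -/

section Operators

/-- Sublinearity: `T` is subadditive and positively homogeneous. -/
def IsSublinear {E : Type*} [AddCommGroup E] [Module ℝ E] [LE E] (T : E → E) : Prop :=
  (∀ f g : E, T (f + g) ≤ T f + T g) ∧ ∀ (α : ℝ) (f : E), 0 ≤ α → T (α • f) = α • T f

/-- Strong translatability with respect to the unit function `one`:
`T (f + α · 1) = T f + α T 1` for all real `α`. -/
def IsStronglyTranslatable {E : Type*} [AddCommGroup E] [Module ℝ E] (one : E) (T : E → E) :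
    Prop :=
  ∀ (f : E) (α : ℝ), T (f + α • one) = T f + α • T one

/-- The norm `inf {c > 0 : ‖T f‖ ≤ c ‖f‖ for all f}` of a (not necessarily linear) operator.
For sublinear monotone operators on `C([0,1])` or `L₁([0,1])` the set of bounds is never empty. -/
noncomputable def opNorm {E : Type*} [NormedAddCommGroup E] (T : E → E) : ℝ :=
  sInf {c : ℝ | 0 < c ∧ ∀ f : E, ‖T f‖ ≤ c * ‖f‖}

/-- The largest of `‖T e₀ - e₀‖`, `‖T e₁ - e₁‖`, `‖T (-e₁) + e₁‖`, `‖T e₂ - e₂‖`. -/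
noncomputable def testError {E : Type*} [NormedAddCommGroup E] (e : ℕ → E) (T : E → E) : ℝ :=
  max (max ‖T (e 0) - e 0‖ ‖T (e 1) - e 1‖) (max ‖T (-e 1) + e 1‖ ‖T (e 2) - e 2‖)

end Operators

/-! ### The spaces `C([0,1])` and `L₁([0,1])` and the monomials in them -/

/-- The space `C([0,1])`, with the supremum norm and the pointwise order. -/
abbrev C01 : Type := C(Set.Icc (0 : ℝ) 1, ℝ)

/-- Lebesgue measure on `[0,1]`. -/
noncomputable abbrev vol01 : Measure ℝ := volume.restrict (Set.Icc (0 : ℝ) 1)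

/-- The space `L₁([0,1])`, with its norm and the almost everywhere order. -/
abbrev L1 : Type := Lp ℝ 1 vol01

/-- The monomial `x ↦ x ^ j` in `C([0,1])`. -/
def monoC (j : ℕ) : C01 := ⟨fun x => (x : ℝ) ^ j, by fun_prop⟩

theorem memLp_monomial (j : ℕ) : MemLp (fun x : ℝ => x ^ j) 1 vol01 := by
  rw [memLp_one_iff_integrable]
  exact (continuous_pow j).continuousOn.integrableOn_Icc

/-- The class of the monomial `x ↦ x ^ j` in `L₁([0,1])`. -/
noncomputable def monoL1 (j : ℕ) : L1 := (memLp_monomial j).toLp _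

/-! ### Moduli of smoothness -/

/-- The `r`-th order difference with step `h`. -/
noncomputable def diff (r : ℕ) (h : ℝ) (f : ℝ → ℝ) (x : ℝ) : ℝ :=
  ∑ j ∈ Finset.range (r + 1), (-1 : ℝ) ^ j * (r.choose j : ℝ) * f (x + ((r : ℝ) - (j : ℝ)) * h)

/-- The points `x` of `[0,1]` for which all of `x, x + h, …, x + r h` lie in `[0,1]`
(it is enough that the two ends do). -/
def diffDomain (r : ℕ) (h : ℝ) : Set ℝ :=
  {x | x ∈ Set.Icc (0 : ℝ) 1 ∧ x + (r : ℝ) * h ∈ Set.Icc (0 : ℝ) 1}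

/-- The modulus of smoothness of order `r` in `L_p([0,1])`: the supremum over `|h| ≤ δ` of
the `L_p` norm of the `r`-th difference over the points where it only uses values of `f`
on `[0,1]`. -/
noncomputable def modulus (r : ℕ) (p : ℝ≥0∞) (f : ℝ → ℝ) (δ : ℝ) : ℝ :=
  (⨆ (h : ℝ) (_ : |h| ≤ δ), eLpNorm (diff r h f) p (volume.restrict (diffDomain r h))).toReal

/-- The modulus of smoothness in the uniform norm of `f ∈ C([0,1])`. -/
noncomputable def modulusC (r : ℕ) (f : C01) (δ : ℝ) : ℝ :=
  modulus r ∞ (Set.IccExtend zero_le_one f) δ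

/-- The modulus of smoothness in the `L₁` norm of `f ∈ L₁([0,1])`. -/
noncomputable def modulusL1 (r : ℕ) (f : L1) (δ : ℝ) : ℝ :=
  modulus r 1 f δ

end Korovkin

/-!
The estimate is proved by comparing `f` with a smooth function `g` for which the Korovkin argument
is quantitative, as in a `K`-functional proof; the step of the smoothing is `k = λ ^ (1 / r)`, with
`λ` the test error, `r = 2` in `C([0,1])` and `r = 3` in `L₁([0,1])`.

*Smooth functions.* If `g`, `g'`, `g''` are bounded by `D` on `[0,1]`, then `g` lies below the
quadratic `g y + g' y (t - y) + D (t - y) ^ 2` for every base point `y`. Monotonicity, sublinearity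
and strong translatability turn this into an upper bound for `T g` by a combination of
`T e₀, T e₁, T (-e₁), T e₂` with coefficients depending continuously on `y`. Putting `y = x` bounds
`T g - g` at `x` by `3 D` times the pointwise error on the test functions. In `L₁` the bound
holds almost everywhere for each `y`, hence almost everywhere simultaneously for all rational `y`,
hence by continuity for all `y`. The same bound for `-g` and `-T g ≤ T (-g)` give
`‖T g - g‖ ≤ 12 D λ` (`C2Bound.norm_apply_sub_le_C01`, `C2Bound.norm_apply_sub_le_L1`).

*Smoothing up to the boundary.* Let `v` be the mean of `r` independent uniform points of `[0,1]`,
and let `g x` be `f x` plus `(-1) ^ (r + 1)` times the average over `v` of the `r`-th difference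
of `f` at `x` with step `k (v - x)`; in this sum the term `f x` cancels. All its nodes `x + j k (v
- x)` are convex combinations of `x` and `v`, so they stay in `[0,1]` and neither an extension of
`f` nor a partition of unity is needed. The difference `f - g` is an average of `r`-th differences
with steps of size at most `k`, so its norm is at most a constant times the modulus `ω`. On the
other hand `g` is a combination of `r`-fold moving averages of `f` evaluated at `(1 - j k) x`, so
its `r`-th derivative is a combination of `r`-th differences divided by `k ^ r`. For `r = 2` this
bounds `g''` itself, for `r = 3` and `p = 1` it bounds the oscillation of `g''`; together with the
norm of `g` both give `D ≤ const * (‖f‖ + k ^ (-r) ω)` (`c2Bound_smooth2`, `c2Bound_smooth3`).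

*Conclusion.* A sublinear monotone operator on a Banach lattice is automatically bounded and
satisfies `|T f - T g| ≤ T |f - g|`, so `‖f - T f‖ ≤ (1 + ‖T‖) ‖f - g‖ + ‖T g - g‖`, and `k ^ r = λ`
turns the second term into `const * (‖f‖ λ + ω)`. The cases of large `λ` and of `λ = 0`, where `T`
fixes all polynomials, are treated separately (`IsSublinear.norm_sub_apply_le_of_smoothing`).
-/

namespace Korovkin

/-! ### Sublinear monotone operators on a Banach lattice -/

section Lattice

variable {E : Type*} [NormedAddCommGroup E] [Lattice E] {T : E → E}

/-- The pointwise error of `T` on the test functions. -/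
def errorFunction (e : ℕ → E) (T : E → E) : E :=
  |T (e 0) - e 0| + |T (e 1) - e 1| + |T (-e 1) + e 1| + |T (e 2) - e 2|

theorem norm_errorFunction_le [HasSolidNorm E] [IsOrderedAddMonoid E] (e : ℕ → E)
    (T : E → E) :
    ‖errorFunction e T‖ ≤ 4 * testError e T := by
  have h0 : ‖T (e 0) - e 0‖ ≤ testError e T := (le_max_left _ _).trans (le_max_left _ _)
  have h1 : ‖T (e 1) - e 1‖ ≤ testError e T := (le_max_right _ _).trans (le_max_left _ _)
  have h2 : ‖T (-e 1) + e 1‖ ≤ testError e T := (le_max_left _ _).trans (le_max_right _ _)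
  have h3 : ‖T (e 2) - e 2‖ ≤ testError e T := (le_max_right _ _).trans (le_max_right _ _)
  have : ‖errorFunction e T‖ ≤
      ‖T (e 0) - e 0‖ + ‖T (e 1) - e 1‖ + ‖T (-e 1) + e 1‖ + ‖T (e 2) - e 2‖ := by
    rw [← norm_abs_eq_norm (T (e 0) - e 0), ← norm_abs_eq_norm (T (e 1) - e 1),
      ← norm_abs_eq_norm (T (-e 1) + e 1), ← norm_abs_eq_norm (T (e 2) - e 2)]
    exact norm_add₄_le
  linarith

variable [NormedSpace ℝ E]

theorem IsSublinear.map_zero (hT : IsSublinear T) : T 0 = 0 := by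
  simpa using hT.2 0 0 le_rfl

variable [IsOrderedAddMonoid E]

theorem IsSublinear.abs_sub_le (hT : IsSublinear T) (hm : Monotone T) (f g : E) :
    |T f - T g| ≤ T |f - g| := by
  have key : ∀ u v : E, T u - T v ≤ T |u - v| := fun u v => by
    have h1 := hT.1 (u - v) v
    rw [sub_add_cancel] at h1
    exact (sub_le_iff_le_add.2 h1).trans (hm (le_abs_self _))
  refine abs_le'.2 ⟨key f g, ?_⟩
  rw [neg_sub, abs_sub_comm]
  exact key g f

theorem IsSublinear.abs_le (hT : IsSublinear T) (hm : Monotone T) (f : E) :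
    |T f| ≤ T |f| := by
  simpa [hT.map_zero] using hT.abs_sub_le hm f 0

/-- A quadratic majorant of `g` is mapped to a majorant of `T g`; the sign of the coefficient
of `e 1` decides which of `T (e 1)`, `T (-e 1)` occurs. -/
theorem IsSublinear.apply_le_of_le_quadratic (hT : IsSublinear T) (hm : Monotone T) {e : ℕ → E}
    (ht : IsStronglyTranslatable (e 0) T) {a b c : ℝ} (hc : 0 ≤ c) {g : E}
    (hg : g ≤ b • e 1 + c • e 2 + a • e 0) :
    T g ≤ (max b 0 • T (e 1) + max (-b) 0 • T (-e 1)) + c • T (e 2) + a • T (e 0) := by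
  have hb : T (b • e 1) ≤ max b 0 • T (e 1) + max (-b) 0 • T (-e 1) := by
    rcases le_total 0 b with h | h
    · simp [h, hT.2 b _ h]
    · have : b • e 1 = (-b) • (-e 1) := by simp
      rw [this, hT.2 (-b) _ (by linarith)]
      simp [h]
  calc T g ≤ T (b • e 1 + c • e 2 + a • e 0) := hm hg
    _ = T (b • e 1 + c • e 2) + a • T (e 0) := ht _ _
    _ ≤ T (b • e 1) + T (c • e 2) + a • T (e 0) := by gcongr; exact hT.1 _ _
    _ ≤ _ := by rw [hT.2 c _ hc]; gcongr

variable [HasSolidNorm E]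

/-- Since `-T g ≤ T (-g)`, one-sided bounds for `g` and `-g` control `T g - g`. -/
theorem IsSublinear.norm_apply_sub_le (hT : IsSublinear T) {e : ℕ → E} {g : E} {D : ℝ}
    (hD : 0 ≤ D) (h1 : T g - g ≤ D • errorFunction e T)
    (h2 : T (-g) - -g ≤ D • errorFunction e T) :
    ‖T g - g‖ ≤ 4 * D * testError e T := by
  have h3 : 0 ≤ T g + T (-g) := by
    have := hT.1 g (-g)
    rwa [add_neg_cancel, hT.map_zero] at this
  have h4 : |T g - g| ≤ D • errorFunction e T := by
    refine abs_le'.2 ⟨h1, le_trans ?_ h2⟩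
    rw [neg_sub, sub_neg_eq_add, add_comm (T (-g)) g, sub_le_iff_le_add, add_assoc]
    exact le_add_of_nonneg_right (by rwa [add_comm])
  calc ‖T g - g‖ ≤ ‖D • errorFunction e T‖ :=
        norm_le_norm_of_abs_le_abs (h4.trans (le_abs_self _))
    _ = D * ‖errorFunction e T‖ := by rw [norm_smul, Real.norm_of_nonneg hD]
    _ ≤ D * (4 * testError e T) := by gcongr; exact norm_errorFunction_le e T
    _ = _ := by ring

variable [PosSMulMono ℝ E]

/-- Automatic continuity: if `T` were unbounded, there would be `f n ≥ 0` with `∑ ‖f n‖ < ∞` and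
`‖T (f n)‖` unbounded, although `0 ≤ T (f n) ≤ T (∑ f k)`. -/
theorem IsSublinear.exists_bound [CompleteSpace E] (hT : IsSublinear T) (hm : Monotone T) :
    ∃ c : ℝ, 0 < c ∧ ∀ f : E, ‖T f‖ ≤ c * ‖f‖ := by
  by_contra! hcon
  choose f hf using fun n : ℕ => hcon ((4 : ℝ) ^ n) (by positivity)
  have hpos : ∀ n, 0 < ‖f n‖ := fun n => by
    rcases (norm_nonneg (f n)).eq_or_lt with h | h
    · have h0 : f n = 0 := norm_eq_zero.1 h.symm
      have := hf n
      simp [h0, hT.map_zero] at this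
    · exact h
  -- The norm of `u n` is `2⁻¹ ^ n`, and that of `T (u n)` is at least `4 ^ n / 2 ^ n = 2 ^ n`.
  set u : ℕ → E := fun n => ((2 : ℝ) ^ n * ‖f n‖)⁻¹ • |f n| with hu
  have hu0 : ∀ n, 0 ≤ u n := fun n => by
    have := hpos n
    exact smul_nonneg (by positivity) (abs_nonneg _)
  have hun : ∀ n, ‖u n‖ = (1 / 2 : ℝ) ^ n := fun n => by
    have := hpos n
    rw [hu, norm_smul, norm_abs_eq_norm, Real.norm_of_nonneg (by positivity)]
    rw [one_div, inv_pow]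
    field_simp
  have hsum : Summable u := by
    refine Summable.of_norm ?_
    simp_rw [hun]
    exact summable_geometric_two
  have hle : ∀ n, ‖T (u n)‖ ≤ ‖T (∑' k, u k)‖ := fun n => by
    have h1 : 0 ≤ T (u n) := by simpa [hT.map_zero] using hm (hu0 n)
    have h2 : T (u n) ≤ T (∑' k, u k) := hm (hsum.le_tsum n fun j _ => hu0 j)
    refine norm_le_norm_of_abs_le_abs ?_
    rw [abs_of_nonneg h1, abs_of_nonneg (h1.trans h2)]
    exact h2
  have hlarge : ∀ n, (2 : ℝ) ^ n ≤ ‖T (u n)‖ := fun n => by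
    have := hpos n
    have h1 : ‖T (f n)‖ ≤ ‖T |f n|‖ :=
      norm_le_norm_of_abs_le_abs ((hT.abs_le hm _).trans (le_abs_self _))
    rw [hu, hT.2 _ _ (by positivity), norm_smul, Real.norm_of_nonneg (by positivity)]
    have h2 : (4 : ℝ) ^ n * ‖f n‖ ≤ ‖T |f n|‖ := (hf n).le.trans h1
    calc (2 : ℝ) ^ n = ((2 : ℝ) ^ n * ‖f n‖)⁻¹ * ((4 : ℝ) ^ n * ‖f n‖) := by
          rw [show (4 : ℝ) = 2 * 2 by norm_num, mul_pow]; field_simp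
      _ ≤ _ := by gcongr
  obtain ⟨n, hn⟩ := pow_unbounded_of_one_lt ‖T (∑' k, u k)‖ (one_lt_two : (1 : ℝ) < 2)
  exact absurd ((hlarge n).trans (hle n)) (not_le.2 hn)

theorem opNorm_nonneg {F : Type*} [NormedAddCommGroup F] (T : F → F) : 0 ≤ opNorm T :=
  Real.sInf_nonneg fun _ hc => hc.1.le

theorem IsSublinear.norm_le_opNorm [CompleteSpace E] (hT : IsSublinear T) (hm : Monotone T)
    (f : E) : ‖T f‖ ≤ opNorm T * ‖f‖ := by
  obtain ⟨c, hc⟩ := hT.exists_bound hm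
  rcases (norm_nonneg f).eq_or_lt with h | h
  · simpa [← h] using hc.2 f
  rw [← div_le_iff₀ h]
  exact le_csInf ⟨c, hc⟩ fun b hb => (div_le_iff₀ h).2 (hb.2 f)

theorem IsSublinear.norm_sub_le [CompleteSpace E] (hT : IsSublinear T) (hm : Monotone T)
    (f g : E) : ‖T f - T g‖ ≤ opNorm T * ‖f - g‖ := by
  calc ‖T f - T g‖ ≤ ‖T |f - g|‖ :=
        norm_le_norm_of_abs_le_abs ((hT.abs_sub_le hm f g).trans (le_abs_self _))
    _ ≤ opNorm T * ‖|f - g|‖ := hT.norm_le_opNorm hm _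
    _ = _ := by rw [norm_abs_eq_norm]

/-- Approximation of `f` by `T f` through an intermediate `g`. -/
theorem IsSublinear.norm_sub_apply_le [CompleteSpace E] (hT : IsSublinear T) (hm : Monotone T)
    (f g : E) : ‖f - T f‖ ≤ (1 + opNorm T) * ‖f - g‖ + ‖T g - g‖ := by
  have h1 := hT.norm_sub_le hm f g
  calc ‖f - T f‖ = ‖(f - g) - (T f - T g) - (T g - g)‖ := by congr 1; abel
    _ ≤ ‖f - g‖ + ‖T f - T g‖ + ‖T g - g‖ :=
        (_root_.norm_sub_le _ _).trans (by gcongr; exact _root_.norm_sub_le _ _)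
    _ ≤ _ := by linarith

theorem testError_nonneg {F : Type*} [NormedAddCommGroup F] (e : ℕ → F) (T : F → F) :
    0 ≤ testError e T :=
  (norm_nonneg _).trans ((le_max_left _ _).trans (le_max_left _ _))

end Lattice

/-! ### Twice differentiable functions -/

/-- `g` is twice differentiable on the line, with derivatives `g'` and `g''`, and the three
functions are bounded by `D` on `[0,1]`. -/
structure C2Bound (g g' g'' : ℝ → ℝ) (D : ℝ) : Prop where
  deriv1 : ∀ x, HasDerivAt g (g' x) x
  deriv2 : ∀ x, HasDerivAt g' (g'' x) x
  bound0 : ∀ x ∈ Set.Icc (0 : ℝ) 1, |g x| ≤ D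
  bound1 : ∀ x ∈ Set.Icc (0 : ℝ) 1, |g' x| ≤ D
  bound2 : ∀ x ∈ Set.Icc (0 : ℝ) 1, |g'' x| ≤ D

namespace C2Bound

variable {g g' g'' : ℝ → ℝ} {D : ℝ}

theorem nonneg (h : C2Bound g g' g'' D) : 0 ≤ D :=
  (abs_nonneg _).trans (h.bound0 0 (by simp))

theorem neg (h : C2Bound g g' g'' D) : C2Bound (-g) (-g') (-g'') D where
  deriv1 x := (h.deriv1 x).neg
  deriv2 x := (h.deriv2 x).neg
  bound0 x hx := by simpa using h.bound0 x hx
  bound1 x hx := by simpa using h.bound1 x hx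
  bound2 x hx := by simpa using h.bound2 x hx

theorem continuous (h : C2Bound g g' g'' D) : Continuous g :=
  continuous_iff_continuousAt.2 fun x => (h.deriv1 x).continuousAt

theorem continuous' (h : C2Bound g g' g'' D) : Continuous g' :=
  continuous_iff_continuousAt.2 fun x => (h.deriv2 x).continuousAt

/-- The Taylor estimate, with the constant `D` instead of the optimal `D / 2`. -/
theorem le_taylor (h : C2Bound g g' g'' D) {x t : ℝ} (hx : x ∈ Set.Icc (0 : ℝ) 1)
    (ht : t ∈ Set.Icc (0 : ℝ) 1) : g t ≤ g x + g' x * (t - x) + D * (t - x) ^ 2 := by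
  have key : ∀ s ∈ Set.Icc (0 : ℝ) 1, |g' s - g' x| ≤ D * |s - x| := fun s hs =>
    Convex.norm_image_sub_le_of_norm_hasDerivWithin_le (f := g') (f' := g'')
      (fun y _ => (h.deriv2 y).hasDerivWithinAt) (fun y hy => h.bound2 y hy)
      (convex_Icc 0 1) hx hs
  have hsub : Set.uIcc x t ⊆ Set.Icc (0 : ℝ) 1 := Set.ordConnected_Icc.uIcc_subset hx ht
  have h2 := Convex.norm_image_sub_le_of_norm_hasDerivWithin_le (s := Set.uIcc x t)
      (f := fun s => g s - g' x * s) (f' := fun s => g' s - g' x * 1) (C := D * |t - x|)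
      (fun y _ => ((h.deriv1 y).sub ((hasDerivAt_id y).const_mul _)).hasDerivWithinAt)
      (fun y hy => by
        rw [mul_one]
        refine (key y (hsub hy)).trans ?_
        have h0 := h.nonneg
        gcongr ?_ * ?_
        exact Set.abs_sub_left_of_mem_uIcc hy)
      (convex_uIcc x t) Set.left_mem_uIcc Set.right_mem_uIcc
  have h3 := (abs_le.1 (Real.norm_eq_abs _ ▸ h2)).2
  rw [Real.norm_eq_abs, mul_assoc, abs_mul_abs_self] at h3
  linarith

/-- The Taylor majorant of `g` at `y`, written in the basis `1, t, t²`. -/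
theorem le_quadratic (h : C2Bound g g' g'' D) {y t : ℝ} (hy : y ∈ Set.Icc (0 : ℝ) 1)
    (ht : t ∈ Set.Icc (0 : ℝ) 1) :
    g t ≤ (g' y - 2 * D * y) * t + D * t ^ 2 + (g y - g' y * y + D * y ^ 2) := by
  linarith [h.le_taylor hy ht]

/-- The image of the Taylor majorant at `x`, evaluated at `x` itself; `u₀, u₁, v₁, u₂` stand for
the values at `x` of `T 1`, `T t`, `T (-t)`, `T t²`. -/
theorem quadratic_image_le (h : C2Bound g g' g'' D) {x : ℝ} (hx : x ∈ Set.Icc (0 : ℝ) 1)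
    (u₀ u₁ v₁ u₂ : ℝ) :
    (max (g' x - 2 * D * x) 0 * u₁ + max (-(g' x - 2 * D * x)) 0 * v₁) + D * u₂
      + (g x - g' x * x + D * x ^ 2) * u₀ - g x ≤
    3 * D * (|u₀ - 1| + |u₁ - x| + |v₁ + x| + |u₂ - x ^ 2|) := by
  have hD := h.nonneg
  have hg0 := abs_le.1 (h.bound0 x hx)
  have hg1 := abs_le.1 (h.bound1 x hx)
  obtain ⟨hx0, hx1⟩ := hx
  have hDx : 0 ≤ D * x := by positivity
  have hDx1 : D * x ≤ D := mul_le_of_le_one_right hD hx1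
  have hDx2 : 0 ≤ D * x ^ 2 := by positivity
  have hDx3 : D * x ^ 2 ≤ D := mul_le_of_le_one_right hD (pow_le_one₀ hx0 hx1)
  have hgx : |g' x * x| ≤ D := by
    rw [abs_mul, abs_of_nonneg hx0]
    exact (mul_le_of_le_one_right (abs_nonneg _) hx1).trans (abs_le.2 hg1)
  have hgx' := abs_le.1 hgx
  set b := g' x - 2 * D * x with hb
  set a := g x - g' x * x + D * x ^ 2 with ha
  have hbb : max b 0 - max (-b) 0 = b := by
    rcases le_total 0 b with h | h <;> simp [h]
  have e1 : max b 0 ≤ 3 * D := max_le (by linarith) (by linarith)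
  have e2 : max (-b) 0 ≤ 3 * D := max_le (by linarith) (by linarith)
  have e3 : |a| ≤ 3 * D := abs_le.2 ⟨by linarith, by linarith⟩
  have i0 : a * (u₀ - 1) ≤ 3 * D * |u₀ - 1| :=
    (le_abs_self _).trans (by rw [abs_mul]; gcongr)
  have i1 : max b 0 * (u₁ - x) ≤ 3 * D * |u₁ - x| :=
    (mul_le_mul_of_nonneg_left (le_abs_self _) (le_max_right _ _)).trans (by gcongr)
  have i2 : max (-b) 0 * (v₁ + x) ≤ 3 * D * |v₁ + x| :=
    (mul_le_mul_of_nonneg_left (le_abs_self _) (le_max_right _ _)).trans (by gcongr)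
  have i3 : D * (u₂ - x ^ 2) ≤ 3 * D * |u₂ - x ^ 2| :=
    (mul_le_mul_of_nonneg_left (le_abs_self _) hD).trans (by gcongr; linarith)
  have hid : (max b 0 * u₁ + max (-b) 0 * v₁) + D * u₂ + a * u₀ - g x
      = a * (u₀ - 1) + max b 0 * (u₁ - x) + max (-b) 0 * (v₁ + x) + D * (u₂ - x ^ 2)
        + ((max b 0 - max (-b) 0) * x + D * x ^ 2 + a - g x) := by ring
  have hz : (max b 0 - max (-b) 0) * x + D * x ^ 2 + a - g x = 0 := by
    rw [hbb, hb, ha]; ring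
  rw [hid, hz]
  linarith

end C2Bound

/-! ### The operator on twice differentiable functions -/

@[simp]
theorem monoC_apply (j : ℕ) (x : Set.Icc (0 : ℝ) 1) : monoC j x = (x : ℝ) ^ j := rfl

instance : HasSolidNorm C01 where
  solid f g h := by
    refine (ContinuousMap.norm_le _ (norm_nonneg _)).2 fun x => ?_
    have h1 : |f x| ≤ |g x| := h x
    exact h1.trans (g.norm_coe_le_norm x)

instance : PosSMulMono ℝ L1 where
  smul_le_smul_of_nonneg_left a ha f g h := by
    rw [← Lp.coeFn_le] at h ⊢
    filter_upwards [h, Lp.coeFn_smul a f, Lp.coeFn_smul a g] with x h1 h2 h3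
    rw [h2, h3]
    exact mul_le_mul_of_nonneg_left h1 ha

variable {g g' g'' : ℝ → ℝ} {D : ℝ}

theorem C2Bound.apply_sub_le_C01 (h : C2Bound g g' g'' D) {T : C01 → C01} (hT : IsSublinear T)
    (hm : Monotone T) (ht : IsStronglyTranslatable (monoC 0) T) {G : C01} (hG : ∀ x, G x = g x) :
    T G - G ≤ (3 * D) • errorFunction monoC T := by
  intro x
  have h1 : T G ≤ _ := hT.apply_le_of_le_quadratic hm ht (a := g x - g' x * x + D * (x : ℝ) ^ 2)
    (b := g' x - 2 * D * x) h.nonneg (g := G) (fun t => by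
      have := h.le_quadratic x.2 t.2
      simpa [hG] using this)
  have h2 := h1 x
  have h3 := h.quadratic_image_le x.2 (T (monoC 0) x) (T (monoC 1) x) (T (-monoC 1) x)
    (T (monoC 2) x)
  have h4 : ((3 * D) • errorFunction monoC T) x = 3 * D * (|T (monoC 0) x - 1| +
      |T (monoC 1) x - x| + |T (-monoC 1) x + x| + |T (monoC 2) x - (x : ℝ) ^ 2|) := by
    simp [errorFunction, mul_add]
  change T G x - G x ≤ ((3 * D) • errorFunction monoC T) x
  rw [h4, hG]
  exact (sub_le_sub_right h2 _).trans h3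

theorem monoL1_ae (j : ℕ) : ∀ᵐ x ∂vol01, monoL1 j x = x ^ j :=
  (memLp_monomial j).coeFn_toLp

/-- For each fixed `y` the image of the Taylor majorant at `y` bounds `T G` almost everywhere.
Both sides being continuous in `y`, it is enough to do so for rational `y`, so that the
exceptional set does not depend on `y` and `y = x` is allowed. -/
theorem C2Bound.apply_sub_le_L1 (h : C2Bound g g' g'' D) {T : L1 → L1} (hT : IsSublinear T)
    (hm : Monotone T) (ht : IsStronglyTranslatable (monoL1 0) T) {G : L1}
    (hG : ∀ᵐ x ∂vol01, G x = g x) :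
    T G - G ≤ (3 * D) • errorFunction monoL1 T := by
  -- Clamping `y` to `[0,1]` makes the bound available for every rational number.
  set p : ℝ → ℝ := fun y => (Set.projIcc (0 : ℝ) 1 zero_le_one y : ℝ) with hp
  have hpc : Continuous p := continuous_subtype_val.comp continuous_projIcc
  have hpm : ∀ y, p y ∈ Set.Icc (0 : ℝ) 1 := fun y => (Set.projIcc (0 : ℝ) 1 zero_le_one y).2
  set a : ℝ → ℝ := fun y => g (p y) - g' (p y) * p y + D * p y ^ 2 with ha
  set b : ℝ → ℝ := fun y => g' (p y) - 2 * D * p y with hb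
  have hac : Continuous a := by
    have := h.continuous; have := h.continuous'; fun_prop
  have hbc : Continuous b := by
    have := h.continuous'; fun_prop
  have hmem : ∀ᵐ x ∂vol01, x ∈ Set.Icc (0 : ℝ) 1 := ae_restrict_mem measurableSet_Icc
  have h1 : ∀ y, ∀ᵐ x ∂vol01, T G x ≤ (max (b y) 0 * T (monoL1 1) x
      + max (-b y) 0 * T (-monoL1 1) x) + D * T (monoL1 2) x + a y * T (monoL1 0) x := fun y => by
    have h2 := hT.apply_le_of_le_quadratic hm ht (a := a y) (b := b y) h.nonneg (g := G) (by
      rw [← Lp.coeFn_le]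
      filter_upwards [hmem, hG, monoL1_ae 0, monoL1_ae 1, monoL1_ae 2,
        Lp.coeFn_add (b y • monoL1 1 + D • monoL1 2) (a y • monoL1 0),
        Lp.coeFn_add (b y • monoL1 1) (D • monoL1 2), Lp.coeFn_smul (b y) (monoL1 1),
        Lp.coeFn_smul D (monoL1 2), Lp.coeFn_smul (a y) (monoL1 0)]
        with x hx h1 h2 h3 h4 h5 h6 h7 h8 h9
      rw [h5, Pi.add_apply, h6, Pi.add_apply, h7, h8, h9, h1]
      simp only [Pi.smul_apply, smul_eq_mul, h2, h3, h4]
      simpa using h.le_quadratic (hpm y) hx)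
    rw [← Lp.coeFn_le] at h2
    filter_upwards [h2,
        Lp.coeFn_add ((max (b y) 0 • T (monoL1 1) + max (-b y) 0 • T (-monoL1 1))
          + D • T (monoL1 2)) (a y • T (monoL1 0)),
        Lp.coeFn_add (max (b y) 0 • T (monoL1 1) + max (-b y) 0 • T (-monoL1 1))
          (D • T (monoL1 2)),
        Lp.coeFn_add (max (b y) 0 • T (monoL1 1)) (max (-b y) 0 • T (-monoL1 1)),
        Lp.coeFn_smul (max (b y) 0) (T (monoL1 1)),
        Lp.coeFn_smul (max (-b y) 0) (T (-monoL1 1)),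
        Lp.coeFn_smul D (T (monoL1 2)), Lp.coeFn_smul (a y) (T (monoL1 0))]
        with x h1 h2 h3 h4 h5 h6 h7 h8
    rw [h2, Pi.add_apply, h3, Pi.add_apply, h4, Pi.add_apply, h5, h6, h7, h8] at h1
    exact h1
  have h2 := ae_all_iff.2 fun q : ℚ => h1 q
  rw [← Lp.coeFn_le]
  filter_upwards [hmem, hG, h2, monoL1_ae 0, monoL1_ae 1, monoL1_ae 2, Lp.coeFn_sub (T G) G,
    Lp.coeFn_smul (3 * D) (errorFunction monoL1 T),
    Lp.coeFn_add (|T (monoL1 0) - monoL1 0| + |T (monoL1 1) - monoL1 1|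
      + |T (-monoL1 1) + monoL1 1|) |T (monoL1 2) - monoL1 2|,
    Lp.coeFn_add (|T (monoL1 0) - monoL1 0| + |T (monoL1 1) - monoL1 1|)
      |T (-monoL1 1) + monoL1 1|,
    Lp.coeFn_add |T (monoL1 0) - monoL1 0| |T (monoL1 1) - monoL1 1|,
    Lp.coeFn_abs (T (monoL1 0) - monoL1 0), Lp.coeFn_abs (T (monoL1 1) - monoL1 1),
    Lp.coeFn_abs (T (-monoL1 1) + monoL1 1), Lp.coeFn_abs (T (monoL1 2) - monoL1 2),
    Lp.coeFn_sub (T (monoL1 0)) (monoL1 0), Lp.coeFn_sub (T (monoL1 1)) (monoL1 1),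
    Lp.coeFn_add (T (-monoL1 1)) (monoL1 1), Lp.coeFn_sub (T (monoL1 2)) (monoL1 2)]
    with x hx hGx hq m0 m1 m2 s0 s1 s2 s3 s4 s5 s6 s7 s8 s9 s10 s11 s12
  have hall : ∀ y : ℝ, T G x ≤ (max (b y) 0 * T (monoL1 1) x
      + max (-b y) 0 * T (-monoL1 1) x) + D * T (monoL1 2) x + a y * T (monoL1 0) x := fun y =>
    Rat.denseRange_cast.induction_on (p := fun y : ℝ => T G x ≤ (max (b y) 0 * T (monoL1 1) x
      + max (-b y) 0 * T (-monoL1 1) x) + D * T (monoL1 2) x + a y * T (monoL1 0) x) y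
      (isClosed_le continuous_const (by fun_prop)) hq
  have hpx : p x = x := by rw [hp]; simp [Set.projIcc_of_mem zero_le_one hx]
  have h3 := h.quadratic_image_le hx (T (monoL1 0) x) (T (monoL1 1) x) (T (-monoL1 1) x)
    (T (monoL1 2) x)
  have h4 := hall x
  simp only [ha, hb, hpx] at h4
  have s2' : errorFunction monoL1 T x = _ := s2
  rw [s0, Pi.sub_apply, s1, Pi.smul_apply, s2', Pi.add_apply, s3, Pi.add_apply, s4, Pi.add_apply,
    s5, s6, s7, s8, s9, s10, s11, s12]
  simp only [Pi.sub_apply, Pi.add_apply, m0, m1, m2, hGx, smul_eq_mul, pow_zero, pow_one]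
  linarith

/-- The quantitative Korovkin estimate for smooth functions in `C([0,1])`. -/
theorem C2Bound.norm_apply_sub_le_C01 (h : C2Bound g g' g'' D) {T : C01 → C01}
    (hT : IsSublinear T) (hm : Monotone T) (ht : IsStronglyTranslatable (monoC 0) T) {G : C01}
    (hG : ∀ x, G x = g x) : ‖T G - G‖ ≤ 12 * D * testError monoC T := by
  have hD := h.nonneg
  have := hT.norm_apply_sub_le (by positivity) (h.apply_sub_le_C01 hT hm ht hG)
    (h.neg.apply_sub_le_C01 hT hm ht (G := -G) (fun x => by simp [hG]))
  linarith

/-- The quantitative Korovkin estimate for smooth functions in `L₁([0,1])`. -/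
theorem C2Bound.norm_apply_sub_le_L1 (h : C2Bound g g' g'' D) {T : L1 → L1}
    (hT : IsSublinear T) (hm : Monotone T) (ht : IsStronglyTranslatable (monoL1 0) T) {G : L1}
    (hG : ∀ᵐ x ∂vol01, G x = g x) : ‖T G - G‖ ≤ 12 * D * testError monoL1 T := by
  have hD := h.nonneg
  have := hT.norm_apply_sub_le (by positivity) (h.apply_sub_le_L1 hT hm ht hG)
    (h.neg.apply_sub_le_L1 hT hm ht (G := -G) (by
      filter_upwards [hG, Lp.coeFn_neg G] with x h1 h2
      rw [h2, Pi.neg_apply, h1, Pi.neg_apply]))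
  linarith

/-! ### Bounding a function and its derivative through the second derivative -/

/-- The value of `g'` at `0` is controlled by `g 1 - g 0` and the bound for `g''`. -/
theorem C2Bound.of_bound_deriv2 {g g' g'' : ℝ → ℝ} {N B : ℝ} (h1 : ∀ x, HasDerivAt g (g' x) x)
    (h2 : ∀ x, HasDerivAt g' (g'' x) x) (hN : ∀ x ∈ Set.Icc (0 : ℝ) 1, |g x| ≤ N)
    (hB : ∀ x ∈ Set.Icc (0 : ℝ) 1, |g'' x| ≤ B) : C2Bound g g' g'' (2 * N + 2 * B) := by
  have m0 : (0 : ℝ) ∈ Set.Icc (0 : ℝ) 1 := by simp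
  have m1 : (1 : ℝ) ∈ Set.Icc (0 : ℝ) 1 := by simp
  have hN0 : 0 ≤ N := (abs_nonneg _).trans (hN 0 m0)
  have hB0 : 0 ≤ B := (abs_nonneg _).trans (hB 0 m0)
  have k1 : ∀ x ∈ Set.Icc (0 : ℝ) 1, |g' x - g' 0| ≤ B := fun x hx => by
    have := Convex.norm_image_sub_le_of_norm_hasDerivWithin_le (f := g') (f' := g'') (C := B)
      (fun y _ => (h2 y).hasDerivWithinAt) (fun y hy => hB y hy) (convex_Icc 0 1) m0 hx
    rw [Real.norm_eq_abs, sub_zero, Real.norm_of_nonneg hx.1] at this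
    exact this.trans (mul_le_of_le_one_right hB0 hx.2)
  have k2 : |g 1 - g' 0 * 1 - (g 0 - g' 0 * 0)| ≤ B := by
    have := Convex.norm_image_sub_le_of_norm_hasDerivWithin_le (f := fun s => g s - g' 0 * s)
      (f' := fun s => g' s - g' 0 * 1) (C := B)
      (fun y _ => ((h1 y).sub ((hasDerivAt_id y).const_mul _)).hasDerivWithinAt)
      (fun y hy => by rw [mul_one]; exact k1 y hy) (convex_Icc 0 1) m0 m1
    simpa using this
  have a0 := abs_le.1 (hN 0 m0)
  have a1 := abs_le.1 (hN 1 m1)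
  have a2 := abs_le.1 k2
  refine ⟨h1, h2, fun x hx => (hN x hx).trans (by linarith), fun x hx => ?_,
    fun x hx => (hB x hx).trans (by linarith)⟩
  have a3 := abs_le.1 (k1 x hx)
  exact abs_le.2 ⟨by linarith, by linarith⟩

/-- Pairing a quadratic polynomial on `[0,1]` with a row `p, q, r` of the inverse Hilbert matrix
recovers one of its coefficients. -/
theorem integral_quadratic_mul_quadratic (a b c p q r : ℝ) :
    ∫ x in (0 : ℝ)..1, (a + b * x + c * x ^ 2) * (p + q * x + r * x ^ 2) =
      a * (p + q / 2 + r / 3) + b * (p / 2 + q / 3 + r / 4) + c * (p / 3 + q / 4 + r / 5) := by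
  have : ∀ x : ℝ, (a + b * x + c * x ^ 2) * (p + q * x + r * x ^ 2) =
      a * p + (a * q + b * p) * x ^ 1 + (a * r + b * q + c * p) * x ^ 2
        + (b * r + c * q) * x ^ 3 + c * r * x ^ 4 := fun x => by ring
  simp_rw [this]
  have hp : ∀ (n : ℕ) (d : ℝ), IntervalIntegrable (fun x : ℝ => d * x ^ n) volume 0 1 :=
    fun n d => (by fun_prop : Continuous fun x : ℝ => d * x ^ n).intervalIntegrable _ _
  rw [intervalIntegral.integral_add ((((intervalIntegrable_const).add (hp 1 _)).add (hp 2 _)).add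
      (hp 3 _)) (hp 4 _),
    intervalIntegral.integral_add (((intervalIntegrable_const).add (hp 1 _)).add (hp 2 _)) (hp 3 _),
    intervalIntegral.integral_add ((intervalIntegrable_const).add (hp 1 _)) (hp 2 _),
    intervalIntegral.integral_add intervalIntegrable_const (hp 1 _)]
  simp only [intervalIntegral.integral_const_mul, integral_pow,
    intervalIntegral.integral_const]
  norm_num
  ring

theorem abs_integral_quadratic_mul_le {a b c p q r M W : ℝ}
    (hM : ∫ x in (0 : ℝ)..1, |a + b * x + c * x ^ 2| ≤ M)
    (hW : |p| + |q| + |r| ≤ W) :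
    |∫ x in (0 : ℝ)..1, (a + b * x + c * x ^ 2) * (p + q * x + r * x ^ 2)| ≤ W * M := by
  have hW0 : 0 ≤ W := le_trans (by positivity) hW
  calc |∫ x in (0 : ℝ)..1, (a + b * x + c * x ^ 2) * (p + q * x + r * x ^ 2)|
      ≤ ∫ x in (0 : ℝ)..1, |(a + b * x + c * x ^ 2) * (p + q * x + r * x ^ 2)| :=
        intervalIntegral.abs_integral_le_integral_abs zero_le_one
    _ ≤ ∫ x in (0 : ℝ)..1, W * |a + b * x + c * x ^ 2| := by
        refine intervalIntegral.integral_mono_on zero_le_one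
          (Continuous.intervalIntegrable (by fun_prop) _ _)
          (Continuous.intervalIntegrable (by fun_prop) _ _) fun x hx => ?_
        rw [abs_mul, mul_comm]
        gcongr
        have hx2 : |x| ≤ 1 := abs_le.2 ⟨by linarith [hx.1], hx.2⟩
        calc |p + q * x + r * x ^ 2| ≤ |p| + |q * x| + |r * x ^ 2| := abs_add_three _ _ _
          _ ≤ |p| + |q| + |r| := by
            rw [abs_mul, abs_mul, abs_pow]
            gcongr
            · exact mul_le_of_le_one_right (abs_nonneg _) hx2
            · exact mul_le_of_le_one_right (abs_nonneg _) (pow_le_one₀ (abs_nonneg _) hx2)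
          _ ≤ W := hW
    _ = W * ∫ x in (0 : ℝ)..1, |a + b * x + c * x ^ 2| := intervalIntegral.integral_const_mul _ _
    _ ≤ W * M := by gcongr

/-- If `g''` oscillates by at most `B`, then `g` is `B`-close in `C²` to its Taylor polynomial
at `0`, and on quadratic polynomials the `L₁` norm dominates the coefficients. -/
theorem C2Bound.of_oscillation_deriv2 {g g' g'' : ℝ → ℝ} {N B : ℝ}
    (h1 : ∀ x, HasDerivAt g (g' x) x) (h2 : ∀ x, HasDerivAt g' (g'' x) x)
    (hN : ∫ x in (0 : ℝ)..1, |g x| ≤ N)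
    (hB : ∀ x ∈ Set.Icc (0 : ℝ) 1, |g'' x - g'' 0| ≤ B) :
    C2Bound g g' g'' (1300 * (N + B)) := by
  have m0 : (0 : ℝ) ∈ Set.Icc (0 : ℝ) 1 := by simp
  have hB0 : 0 ≤ B := (abs_nonneg _).trans (hB 0 m0)
  have hN0 : 0 ≤ N :=
    (intervalIntegral.integral_nonneg zero_le_one fun x _ => abs_nonneg (g x)).trans hN
  have k1 : ∀ x ∈ Set.Icc (0 : ℝ) 1, |g' x - g' 0 - g'' 0 * x| ≤ B := fun x hx => by
    have := Convex.norm_image_sub_le_of_norm_hasDerivWithin_le (f := fun s => g' s - g'' 0 * s)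
      (f' := fun s => g'' s - g'' 0 * 1) (C := B)
      (fun y _ => ((h2 y).sub ((hasDerivAt_id y).const_mul _)).hasDerivWithinAt)
      (fun y hy => by rw [mul_one]; exact hB y hy) (convex_Icc 0 1) m0 hx
    rw [Real.norm_eq_abs, sub_zero, Real.norm_of_nonneg hx.1] at this
    refine le_trans (le_of_eq ?_) (this.trans (mul_le_of_le_one_right hB0 hx.2))
    congr 1; ring
  have k2 : ∀ x ∈ Set.Icc (0 : ℝ) 1, |g x - (g 0 + g' 0 * x + g'' 0 / 2 * x ^ 2)| ≤ B :=
    fun x hx => by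
    have := Convex.norm_image_sub_le_of_norm_hasDerivWithin_le
      (f := fun s => g s - (g' 0 * s + g'' 0 / 2 * s ^ 2))
      (f' := fun s => g' s - (g' 0 * 1 + g'' 0 / 2 * (2 * s))) (C := B)
      (fun y _ => ((h1 y).sub (((hasDerivAt_id y).const_mul _).add
        (((hasDerivAt_pow 2 y).const_mul _).congr_deriv (by norm_num)))).hasDerivWithinAt)
      (fun y hy => by
        refine le_trans (le_of_eq ?_) (k1 y hy)
        rw [Real.norm_eq_abs]; congr 1; ring) (convex_Icc 0 1) m0 hx
    rw [Real.norm_eq_abs, sub_zero, Real.norm_of_nonneg hx.1] at this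
    refine le_trans (le_of_eq ?_) (this.trans (mul_le_of_le_one_right hB0 hx.2))
    congr 1; ring
  have hgc : Continuous g := continuous_iff_continuousAt.2 fun x => (h1 x).continuousAt
  set a := g 0 with ha
  set b := g' 0 with hb
  set c := g'' 0 / 2 with hc
  have hq : ∫ x in (0 : ℝ)..1, |a + b * x + c * x ^ 2| ≤ N + B := by
    calc ∫ x in (0 : ℝ)..1, |a + b * x + c * x ^ 2| ≤ ∫ x in (0 : ℝ)..1, (|g x| + B) := by
          refine intervalIntegral.integral_mono_on zero_le_one
            (Continuous.intervalIntegrable (by fun_prop) _ _)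
            (Continuous.intervalIntegrable (by fun_prop) _ _) fun x hx => ?_
          have i1 := abs_le.1 (k2 x hx)
          have i2 := le_abs_self (g x)
          have i3 := neg_abs_le (g x)
          exact abs_le.2 ⟨by linarith, by linarith⟩
      _ = (∫ x in (0 : ℝ)..1, |g x|) + B := by
          rw [intervalIntegral.integral_add (Continuous.intervalIntegrable (by fun_prop) _ _)
            intervalIntegrable_const]
          simp
      _ ≤ N + B := by gcongr
  have ca : |a| ≤ 75 * (N + B) := by
    have := abs_integral_quadratic_mul_le (p := 9) (q := -36) (r := 30) (W := 75) hq
      (by norm_num)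
    rw [integral_quadratic_mul_quadratic] at this
    convert this using 2; ring
  have cb : |b| ≤ 408 * (N + B) := by
    have := abs_integral_quadratic_mul_le (p := -36) (q := 192) (r := -180) (W := 408) hq
      (by norm_num)
    rw [integral_quadratic_mul_quadratic] at this
    convert this using 2; ring
  have cc : |c| ≤ 390 * (N + B) := by
    have := abs_integral_quadratic_mul_le (p := 30) (q := -180) (r := 180) (W := 390) hq
      (by norm_num)
    rw [integral_quadratic_mul_quadratic] at this
    convert this using 2; ring
  have hgc2 : g'' 0 = 2 * c := by rw [hc]; ring
  have ea := abs_le.1 ca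
  have eb := abs_le.1 cb
  have small : ∀ {u v : ℝ}, v ∈ Set.Icc (0 : ℝ) 1 → |u * v| ≤ |u| := fun {u v} hv => by
    rw [abs_mul, abs_of_nonneg hv.1]
    exact mul_le_of_le_one_right (abs_nonneg _) hv.2
  refine ⟨h1, h2, fun x hx => ?_, fun x hx => ?_, fun x hx => ?_⟩
  · have i1 := abs_le.1 (k2 x hx)
    have i2 := abs_le.1 ((small (u := b) hx).trans cb)
    have i3 := abs_le.1 ((small (u := c) (v := x ^ 2)
      ⟨by positivity, pow_le_one₀ hx.1 hx.2⟩).trans cc)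
    exact abs_le.2 ⟨by linarith, by linarith⟩
  · have i1 := abs_le.1 (k1 x hx)
    have i3 := abs_le.1 ((small (u := c) hx).trans cc)
    rw [hgc2, mul_assoc] at i1
    exact abs_le.2 ⟨by linarith, by linarith⟩
  · have i1 := abs_le.1 (hB x hx)
    have i3 := abs_le.1 cc
    rw [hgc2] at i1
    exact abs_le.2 ⟨by linarith, by linarith⟩

/-! ### Moving averages -/

/-- The average of `f` over the interval between `z` and `z + h`, as an integral over `[0,1]`. -/
noncomputable def avg (h : ℝ) (f : ℝ → ℝ) (z : ℝ) : ℝ := ∫ u in (0 : ℝ)..1, f (z + h * u)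

theorem avg_eq_sub {h : ℝ} (hh : h ≠ 0) {f : ℝ → ℝ}
    (hf : ∀ a b, IntervalIntegrable f volume a b) (z : ℝ) :
    avg h f z = h⁻¹ * ((∫ t in (0 : ℝ)..(z + h), f t) - ∫ t in (0 : ℝ)..z, f t) := by
  rw [avg, intervalIntegral.integral_comp_add_mul _ hh,
    intervalIntegral.integral_interval_sub_left (hf _ _) (hf _ _)]
  simp

theorem continuous_avg {h : ℝ} (hh : h ≠ 0) {f : ℝ → ℝ}
    (hf : ∀ a b, IntervalIntegrable f volume a b) : Continuous (avg h f) := by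
  have hF : Continuous fun z => ∫ t in (0 : ℝ)..z, f t := intervalIntegral.continuous_primitive hf 0
  rw [show avg h f = _ from funext (avg_eq_sub hh hf)]
  exact continuous_const.mul ((hF.comp (by fun_prop)).sub hF)

theorem hasDerivAt_avg {h : ℝ} (hh : h ≠ 0) {f : ℝ → ℝ} (hf : Continuous f) (z : ℝ) :
    HasDerivAt (avg h f) (h⁻¹ * (f (z + h) - f z)) z := by
  have hi : ∀ a b, IntervalIntegrable f volume a b := fun a b => hf.intervalIntegrable a b
  have hF : ∀ z, HasDerivAt (fun z => ∫ t in (0 : ℝ)..z, f t) (f z) z := fun z =>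
    intervalIntegral.integral_hasDerivAt_right (hi _ _)
      (hf.stronglyMeasurableAtFilter _ _) hf.continuousAt
  rw [show avg h f = _ from funext (avg_eq_sub hh hi)]
  exact (((hF (z + h)).comp_add_const z h).sub (hF z)).const_mul _

theorem diff_two (h : ℝ) (f : ℝ → ℝ) (x : ℝ) :
    diff 2 h f x = f (x + 2 * h) - 2 * f (x + h) + f x := by
  simp [diff, Finset.sum_range_succ]
  ring_nf

theorem diff_three (h : ℝ) (f : ℝ → ℝ) (x : ℝ) :
    diff 3 h f x = f (x + 3 * h) - 3 * f (x + 2 * h) + 3 * f (x + h) - f x := by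
  simp [diff, Finset.sum_range_succ, Nat.choose]
  ring_nf

/-- The second derivative of the twofold average. -/
theorem hasDerivAt_avg_avg {h : ℝ} (hh : h ≠ 0) {f : ℝ → ℝ} (hf : Continuous f) (z : ℝ) :
    HasDerivAt (fun z => h⁻¹ * (avg h f (z + h) - avg h f z)) ((h⁻¹) ^ 2 * diff 2 h f z) z := by
  refine ((((hasDerivAt_avg hh hf (z + h)).comp_add_const z h).sub
    (hasDerivAt_avg hh hf z)).const_mul _).congr_deriv ?_
  rw [diff_two, two_mul, ← add_assoc]
  ring

/-! ### Steps inside the unit interval -/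

theorem mem_diffDomain {r : ℕ} {h x : ℝ} : x ∈ diffDomain r h ↔
    x ∈ Set.Icc (0 : ℝ) 1 ∧ x + (r : ℝ) * h ∈ Set.Icc (0 : ℝ) 1 := Iff.rfl

/-- A step towards a point `v` of `[0,1]` stays in `[0,1]`. -/
theorem mem_diffDomain_mul_sub {r : ℕ} {k v x : ℝ} (hk : 0 ≤ k) (hrk : r * k ≤ 1)
    (hx : x ∈ Set.Icc (0 : ℝ) 1) (hv : v ∈ Set.Icc (0 : ℝ) 1) :
    x ∈ diffDomain r (k * (v - x)) := by
  refine ⟨hx, ?_⟩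
  have h0 : 0 ≤ (r : ℝ) * k := by positivity
  have : x + (r : ℝ) * (k * (v - x)) = (1 - r * k) * x + (r * k) * v := by ring
  rw [this]
  exact convex_Icc (0 : ℝ) 1 hx hv (by linarith) h0 (by ring)

theorem abs_mul_sub_le {k v x : ℝ} (hk : 0 ≤ k) (hx : x ∈ Set.Icc (0 : ℝ) 1)
    (hv : v ∈ Set.Icc (0 : ℝ) 1) : |k * (v - x)| ≤ k := by
  rw [abs_mul, abs_of_nonneg hk]
  exact mul_le_of_le_one_right hk
    (abs_le.2 ⟨by linarith [hv.1, hx.2], by linarith [hv.2, hx.1]⟩)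

/-- An initial point of a forward step. -/
theorem mem_diffDomain_of_le {r : ℕ} {h z : ℝ} (hh : 0 ≤ h) (hz : 0 ≤ z)
    (hz1 : z + r * h ≤ 1) : z ∈ diffDomain r h := by
  have : 0 ≤ (r : ℝ) * h := by positivity
  exact ⟨⟨hz, by linarith⟩, ⟨by linarith, hz1⟩⟩

theorem _root_.HasDerivAt.dilate {P : ℝ → ℝ} {p c x : ℝ} (h : HasDerivAt P p (c * x)) :
    HasDerivAt (fun x => P (c * x)) (c * p) x :=
  (h.comp x ((hasDerivAt_id x).const_mul c)).congr_deriv (by ring)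

/-! ### Smoothing of continuous functions -/

/-- The smoothing of `f` for second differences. Its value at `x` is `f x` minus the average of
`diff 2 (k * ((u + v) / 2 - x)) f x` over `u, v ∈ [0,1]`. -/
noncomputable def smooth2 (k : ℝ) (f : ℝ → ℝ) (x : ℝ) : ℝ :=
  2 * avg (k / 2) (avg (k / 2) f) ((1 - k) * x) - avg k (avg k f) ((1 - 2 * k) * x)

/-- The derivative of `smooth2 k f`. -/
noncomputable def smooth2Deriv (k : ℝ) (f : ℝ → ℝ) (x : ℝ) : ℝ :=
  2 * ((1 - k) * ((k / 2)⁻¹ * (avg (k / 2) f ((1 - k) * x + k / 2) - avg (k / 2) f ((1 - k) * x))))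
    - (1 - 2 * k) * (k⁻¹ * (avg k f ((1 - 2 * k) * x + k) - avg k f ((1 - 2 * k) * x)))

/-- The second derivative of `smooth2 k f`. -/
noncomputable def smooth2Deriv2 (k : ℝ) (f : ℝ → ℝ) (x : ℝ) : ℝ :=
  2 * ((1 - k) * ((1 - k) * ((k / 2)⁻¹ ^ 2 * diff 2 (k / 2) f ((1 - k) * x))))
    - (1 - 2 * k) * ((1 - 2 * k) * (k⁻¹ ^ 2 * diff 2 k f ((1 - 2 * k) * x)))

section Continuous

variable {k N W : ℝ} {f : ℝ → ℝ}

theorem hasDerivAt_smooth2 (hk : 0 < k) (hf : Continuous f) (x : ℝ) :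
    HasDerivAt (smooth2 k f) (smooth2Deriv k f x) x := by
  have hi : ∀ a b, IntervalIntegrable f volume a b := fun a b => hf.intervalIntegrable a b
  have hk2 : k / 2 ≠ 0 := by positivity
  exact ((hasDerivAt_avg hk2 (continuous_avg hk2 hi) _).dilate.const_mul 2).sub
    (hasDerivAt_avg hk.ne' (continuous_avg hk.ne' hi) _).dilate

theorem hasDerivAt_smooth2Deriv (hk : 0 < k) (hf : Continuous f) (x : ℝ) :
    HasDerivAt (smooth2Deriv k f) (smooth2Deriv2 k f x) x := by
  have hk2 : k / 2 ≠ 0 := by positivity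
  exact (((hasDerivAt_avg_avg hk2 hf _).dilate.const_mul _).const_mul 2).sub
    ((hasDerivAt_avg_avg hk.ne' hf _).dilate.const_mul _)

theorem sub_smooth2 (hk : 0 < k) (hf : Continuous f) (x : ℝ) :
    f x - smooth2 k f x =
      ∫ u in (0 : ℝ)..1, ∫ v in (0 : ℝ)..1, diff 2 (k * ((u + v) / 2 - x)) f x := by
  have hi : ∀ a b, IntervalIntegrable f volume a b := fun a b => hf.intervalIntegrable a b
  have hk2 : k / 2 ≠ 0 := by positivity
  have hc1 := continuous_avg hk.ne' hi
  have hc2 := continuous_avg hk2 hi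
  have e : ∀ (a b : ℝ → ℝ) (c : ℝ), Continuous a → Continuous b →
      ∫ u in (0 : ℝ)..1, (a u - 2 * b u + c) =
        (∫ u in (0 : ℝ)..1, a u) - 2 * (∫ u in (0 : ℝ)..1, b u) + c := by
    intro a b c ha hb
    rw [intervalIntegral.integral_add (Continuous.intervalIntegrable (by fun_prop) _ _)
        intervalIntegrable_const,
      intervalIntegral.integral_sub (ha.intervalIntegrable _ _)
        (Continuous.intervalIntegrable (by fun_prop) _ _), intervalIntegral.integral_const_mul]
    simp
  have e1 : ∀ u : ℝ, ∫ v in (0 : ℝ)..1, diff 2 (k * ((u + v) / 2 - x)) f x =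
      avg k f ((1 - 2 * k) * x + k * u) - 2 * avg (k / 2) f ((1 - k) * x + k / 2 * u) + f x :=
    fun u => by
      rw [avg, avg, ← e _ _ _ (by fun_prop) (by fun_prop)]
      congr 1 with v
      rw [diff_two]
      ring_nf
  simp_rw [e1]
  rw [e _ _ _ (by fun_prop) (by fun_prop), smooth2, avg.eq_1 k (avg k f),
    avg.eq_1 (k / 2) (avg (k / 2) f)]
  ring

theorem abs_sub_smooth2_le (hk : 0 < k) (hk2 : k ≤ 1 / 2) (hf : Continuous f)
    (hW : ∀ s x, |s| ≤ k → x ∈ diffDomain 2 s → |diff 2 s f x| ≤ W) {x : ℝ}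
    (hx : x ∈ Set.Icc (0 : ℝ) 1) : |f x - smooth2 k f x| ≤ W := by
  rw [sub_smooth2 hk hf, ← Real.norm_eq_abs]
  have e : W * |(1 : ℝ) - 0| = W := by simp
  refine (intervalIntegral.norm_integral_le_of_norm_le_const fun u hu => ?_).trans_eq e
  refine (intervalIntegral.norm_integral_le_of_norm_le_const fun v hv => ?_).trans_eq e
  rw [Set.uIoc_of_le zero_le_one] at hu hv
  have hm : (u + v) / 2 ∈ Set.Icc (0 : ℝ) 1 :=
    ⟨by linarith [hu.1, hv.1], by linarith [hu.2, hv.2]⟩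
  exact hW _ _ (abs_mul_sub_le hk.le hx hm)
    (mem_diffDomain_mul_sub hk.le (by push_cast; linarith) hx hm)

/-- The smoothing has a second derivative of order `k⁻² W`, because two moving averages turn the
second derivative into second differences. -/
theorem c2Bound_smooth2 (hk : 0 < k) (hk2 : k ≤ 1 / 2) (hf : Continuous f)
    (hN : ∀ x ∈ Set.Icc (0 : ℝ) 1, |f x| ≤ N)
    (hW : ∀ s x, |s| ≤ k → x ∈ diffDomain 2 s → |diff 2 s f x| ≤ W) :
    C2Bound (smooth2 k f) (smooth2Deriv k f) (smooth2Deriv2 k f) (20 * (N + k⁻¹ ^ 2 * W)) := by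
  have hW0 : 0 ≤ W := (abs_nonneg _).trans (hW 0 0 (by simpa using hk.le)
    ⟨by simp, by simp⟩)
  have hN0 : 0 ≤ N := (abs_nonneg _).trans (hN 0 (by simp))
  have hk1 : 1 ≤ k⁻¹ ^ 2 := one_le_pow₀ ((one_le_inv₀ hk).2 (by linarith))
  have hWk : W ≤ k⁻¹ ^ 2 * W := le_mul_of_one_le_left hW0 hk1
  have h := C2Bound.of_bound_deriv2 (N := N + W) (B := 9 * (k⁻¹ ^ 2 * W))
    (hasDerivAt_smooth2 hk hf) (hasDerivAt_smooth2Deriv hk hf)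
    (fun x hx => by
      have h1 := abs_le.1 (hN x hx)
      have h2 := abs_le.1 (abs_sub_smooth2_le hk hk2 hf hW hx)
      exact abs_le.2 ⟨by linarith, by linarith⟩)
    (fun x hx => by
      have d1 := hW (k / 2) ((1 - k) * x) (by rw [abs_of_pos] <;> linarith)
        (mem_diffDomain_of_le (by positivity) (mul_nonneg (by linarith) hx.1)
          (by push_cast; nlinarith [hx.2]))
      have d2 := hW k ((1 - 2 * k) * x) (by rw [abs_of_pos hk])
        (mem_diffDomain_of_le hk.le (mul_nonneg (by linarith) hx.1)
          (by push_cast; nlinarith [hx.2]))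
      have b1 : |1 - k| ≤ 1 := abs_le.2 ⟨by linarith, by linarith⟩
      have b2 : |1 - 2 * k| ≤ 1 := abs_le.2 ⟨by linarith, by linarith⟩
      have small : ∀ {u v : ℝ}, |u| ≤ 1 → |u * v| ≤ |v| := fun {u v} hu => by
        rw [abs_mul]; exact mul_le_of_le_one_left (abs_nonneg _) hu
      have t1 := (small (v := (1 - k) * ((k / 2)⁻¹ ^ 2 * diff 2 (k / 2) f ((1 - k) * x))) b1).trans
        (small b1)
      have t2 := (small (v := (1 - 2 * k) * (k⁻¹ ^ 2 * diff 2 k f ((1 - 2 * k) * x))) b2).trans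
        (small b2)
      have s1 : |(k / 2)⁻¹ ^ 2 * diff 2 (k / 2) f ((1 - k) * x)| ≤ 4 * (k⁻¹ ^ 2 * W) := by
        rw [abs_mul, abs_of_nonneg (by positivity), inv_div, div_pow, div_eq_mul_inv, ← inv_pow,
          show (2 : ℝ) ^ 2 = 4 by norm_num, mul_assoc]
        gcongr
      have s2 : |k⁻¹ ^ 2 * diff 2 k f ((1 - 2 * k) * x)| ≤ k⁻¹ ^ 2 * W := by
        rw [abs_mul, abs_of_nonneg (by positivity)]
        gcongr
      have r1 := abs_le.1 (t1.trans s1)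
      have r2 := abs_le.1 (t2.trans s2)
      rw [smooth2Deriv2]
      exact abs_le.2 ⟨by linarith, by linarith⟩)
  exact ⟨h.deriv1, h.deriv2, fun x hx => (h.bound0 x hx).trans (by linarith),
    fun x hx => (h.bound1 x hx).trans (by linarith),
    fun x hx => (h.bound2 x hx).trans (by linarith)⟩

end Continuous

/-! ### Smoothing of integrable functions -/

/-- The smoothing of `f` for third differences. Its value at `x` is `f x` plus the average of
`diff 3 (k * ((u + v + w) / 3 - x)) f x` over `u, v, w ∈ [0,1]`. -/
noncomputable def smooth3 (k : ℝ) (f : ℝ → ℝ) (x : ℝ) : ℝ :=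
  3 * avg (k / 3) (avg (k / 3) (avg (k / 3) f)) ((1 - k) * x)
    - 3 * avg (2 * k / 3) (avg (2 * k / 3) (avg (2 * k / 3) f)) ((1 - 2 * k) * x)
    + avg k (avg k (avg k f)) ((1 - 3 * k) * x)

/-- The derivative of the threefold average. -/
noncomputable def avg3Deriv (h : ℝ) (f : ℝ → ℝ) (z : ℝ) : ℝ :=
  h⁻¹ * (avg h (avg h f) (z + h) - avg h (avg h f) z)

/-- The second derivative of the threefold average. -/
noncomputable def avg3Deriv2 (h : ℝ) (f : ℝ → ℝ) (z : ℝ) : ℝ :=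
  h⁻¹ ^ 2 * diff 2 h (avg h f) z

/-- The derivative of `smooth3 k f`. -/
noncomputable def smooth3Deriv (k : ℝ) (f : ℝ → ℝ) (x : ℝ) : ℝ :=
  3 * ((1 - k) * avg3Deriv (k / 3) f ((1 - k) * x))
    - 3 * ((1 - 2 * k) * avg3Deriv (2 * k / 3) f ((1 - 2 * k) * x))
    + (1 - 3 * k) * avg3Deriv k f ((1 - 3 * k) * x)

/-- The second derivative of `smooth3 k f`. -/
noncomputable def smooth3Deriv2 (k : ℝ) (f : ℝ → ℝ) (x : ℝ) : ℝ :=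
  3 * ((1 - k) * ((1 - k) * avg3Deriv2 (k / 3) f ((1 - k) * x)))
    - 3 * ((1 - 2 * k) * ((1 - 2 * k) * avg3Deriv2 (2 * k / 3) f ((1 - 2 * k) * x)))
    + (1 - 3 * k) * ((1 - 3 * k) * avg3Deriv2 k f ((1 - 3 * k) * x))

section Integrable

variable {k N W : ℝ} {f : ℝ → ℝ}

theorem hasDerivAt_smooth3 (hk : 0 < k) (hf : Integrable f) (x : ℝ) :
    HasDerivAt (smooth3 k f) (smooth3Deriv k f x) x := by
  have hi : ∀ a b, IntervalIntegrable f volume a b := fun a b => hf.intervalIntegrable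
  have key : ∀ {h : ℝ}, h ≠ 0 → ∀ z,
      HasDerivAt (avg h (avg h (avg h f))) (avg3Deriv h f z) z := fun hh z =>
    hasDerivAt_avg hh
      (continuous_avg hh fun a b => (continuous_avg hh hi).intervalIntegrable a b) z
  have hk2 : k / 3 ≠ 0 := by positivity
  have hk3 : 2 * k / 3 ≠ 0 := by positivity
  exact (((key hk2 _).dilate.const_mul 3).sub ((key hk3 _).dilate.const_mul 3)).add
    (key hk.ne' _).dilate

theorem hasDerivAt_smooth3Deriv (hk : 0 < k) (hf : Integrable f) (x : ℝ) :
    HasDerivAt (smooth3Deriv k f) (smooth3Deriv2 k f x) x := by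
  have hi : ∀ a b, IntervalIntegrable f volume a b := fun a b => hf.intervalIntegrable
  have key : ∀ {h : ℝ}, h ≠ 0 → ∀ z,
      HasDerivAt (avg3Deriv h f) (avg3Deriv2 h f z) z := fun hh z =>
    hasDerivAt_avg_avg hh (continuous_avg hh hi) z
  have hk2 : k / 3 ≠ 0 := by positivity
  have hk3 : 2 * k / 3 ≠ 0 := by positivity
  exact ((((key hk2 _).dilate.const_mul _).const_mul 3).sub
    (((key hk3 _).dilate.const_mul _).const_mul 3)).add ((key hk.ne' _).dilate.const_mul _)

/-- The second derivative of the threefold average is, up to a constant, the integral of the third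
difference. -/
theorem avg3Deriv2_sub {h : ℝ} (hh : h ≠ 0) (hf : Integrable f) (y z : ℝ) :
    avg3Deriv2 h f z - avg3Deriv2 h f y = h⁻¹ ^ 3 * ∫ t in y..z, diff 3 h f t := by
  have hi : ∀ a b, IntervalIntegrable f volume a b := fun a b => hf.intervalIntegrable
  have hs : ∀ c, IntervalIntegrable (fun t => f (t + c)) volume y z := fun c =>
    (hf.comp_add_right c).intervalIntegrable
  set F : ℝ → ℝ := fun z => ∫ t in (0 : ℝ)..z, f t with hF
  have e0 : ∀ c, ∫ t in y..z, f (t + c) = F (z + c) - F (y + c) := fun c => by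
    rw [intervalIntegral.integral_comp_add_right,
      intervalIntegral.integral_interval_sub_left (hi _ _) (hi _ _)]
  have e1 : ∫ t in y..z, f t = F z - F y := by simpa using e0 0
  simp_rw [avg3Deriv2, diff_two, diff_three, avg_eq_sub hh hi]
  rw [intervalIntegral.integral_sub (((hs _).sub ((hs _).const_mul 3)).add ((hs _).const_mul 3))
      (hi _ _), intervalIntegral.integral_add ((hs _).sub ((hs _).const_mul 3))
      ((hs _).const_mul 3), intervalIntegral.integral_sub (hs _) ((hs _).const_mul 3),
    intervalIntegral.integral_const_mul, intervalIntegral.integral_const_mul, e0, e0, e0, e1]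
  have a1 : ∀ w, w + 2 * h + h = w + 3 * h := fun w => by ring
  have a2 : ∀ w, w + h + h = w + 2 * h := fun w => by ring
  simp only [a1, a2]
  ring

theorem abs_avg3Deriv2_sub_le {h : ℝ} (hh : 0 < h) (hf : Integrable f) (hW0 : 0 ≤ W)
    (hW : eLpNorm (diff 3 h f) 1 (volume.restrict (diffDomain 3 h)) ≤ ENNReal.ofReal W)
    {y z : ℝ} (hy : 0 ≤ y) (hyz : y ≤ z) (hz : z + 3 * h ≤ 1) :
    |avg3Deriv2 h f z - avg3Deriv2 h f y| ≤ h⁻¹ ^ 3 * W := by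
  rw [avg3Deriv2_sub hh.ne' hf, abs_mul, abs_of_nonneg (by positivity)]
  gcongr
  rw [← Real.norm_eq_abs, ← ENNReal.ofReal_le_ofReal_iff hW0, ofReal_norm,
    intervalIntegral.integral_of_le hyz]
  refine (enorm_integral_le_lintegral_enorm _).trans (le_trans ?_ hW)
  rw [eLpNorm_one_eq_lintegral_enorm]
  refine lintegral_mono_set fun t ht => ?_
  exact mem_diffDomain_of_le hh.le (hy.trans ht.1.le) (by push_cast; linarith [ht.2])

theorem sub_smooth3 (hk : 0 < k) (hf : Integrable f) (x : ℝ) :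
    smooth3 k f x - f x = ∫ u in (0 : ℝ)..1, ∫ v in (0 : ℝ)..1, ∫ w in (0 : ℝ)..1,
      diff 3 (k * ((u + v + w) / 3 - x)) f x := by
  have hi : ∀ a b, IntervalIntegrable f volume a b := fun a b => hf.intervalIntegrable
  have hk2 : k / 3 ≠ 0 := by positivity
  have hk3 : 2 * k / 3 ≠ 0 := by positivity
  have hc : ∀ {h : ℝ}, h ≠ 0 → Continuous (avg h f) := fun hh => continuous_avg hh hi
  have hcc : ∀ {h : ℝ}, h ≠ 0 → Continuous (avg h (avg h f)) := fun hh =>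
    continuous_avg hh fun a b => (hc hh).intervalIntegrable a b
  have c1 := hc hk.ne'
  have c2 := hc hk2
  have c3 := hc hk3
  have d1 := hcc hk.ne'
  have d2 := hcc hk2
  have d3 := hcc hk3
  have e : ∀ (a b c : ℝ → ℝ) (d : ℝ), IntervalIntegrable a volume 0 1 →
      IntervalIntegrable b volume 0 1 → IntervalIntegrable c volume 0 1 →
      ∫ u in (0 : ℝ)..1, (a u - 3 * b u + 3 * c u - d) =
        (∫ u in (0 : ℝ)..1, a u) - 3 * (∫ u in (0 : ℝ)..1, b u)
          + 3 * (∫ u in (0 : ℝ)..1, c u) - d := by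
    intro a b c d ha hb hc
    rw [intervalIntegral.integral_sub ((ha.sub (hb.const_mul 3)).add (hc.const_mul 3))
        intervalIntegrable_const, intervalIntegral.integral_add (ha.sub (hb.const_mul 3))
        (hc.const_mul 3), intervalIntegral.integral_sub ha (hb.const_mul 3),
      intervalIntegral.integral_const_mul, intervalIntegral.integral_const_mul]
    simp
  have hint : ∀ {h : ℝ} (z : ℝ), h ≠ 0 →
      IntervalIntegrable (fun w => f (z + h * w)) volume 0 1 := fun z hh =>
    ((hf.comp_add_left z).comp_mul_left' hh).intervalIntegrable
  have e1 : ∀ u v : ℝ, ∫ w in (0 : ℝ)..1, diff 3 (k * ((u + v + w) / 3 - x)) f x =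
      avg k f ((1 - 3 * k) * x + k * u + k * v)
        - 3 * avg (2 * k / 3) f ((1 - 2 * k) * x + 2 * k / 3 * u + 2 * k / 3 * v)
        + 3 * avg (k / 3) f ((1 - k) * x + k / 3 * u + k / 3 * v) - f x := fun u v => by
    rw [avg, avg, avg, ← e _ _ _ _ (hint _ hk.ne') (hint _ hk3) (hint _ hk2)]
    congr 1 with w
    rw [diff_three]
    ring_nf
  have e2 : ∀ u : ℝ, ∫ v in (0 : ℝ)..1, ∫ w in (0 : ℝ)..1,
        diff 3 (k * ((u + v + w) / 3 - x)) f x =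
      avg k (avg k f) ((1 - 3 * k) * x + k * u)
        - 3 * avg (2 * k / 3) (avg (2 * k / 3) f) ((1 - 2 * k) * x + 2 * k / 3 * u)
        + 3 * avg (k / 3) (avg (k / 3) f) ((1 - k) * x + k / 3 * u) - f x := fun u => by
    simp_rw [e1]
    rw [avg.eq_1 k (avg k f), avg.eq_1 (k / 3) (avg (k / 3) f),
      avg.eq_1 (2 * k / 3) (avg (2 * k / 3) f),
      ← e _ _ _ _ (Continuous.intervalIntegrable (by fun_prop) _ _)
      (Continuous.intervalIntegrable (by fun_prop) _ _)
      (Continuous.intervalIntegrable (by fun_prop) _ _)]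
  simp_rw [e2]
  rw [e _ _ _ _ (Continuous.intervalIntegrable (by fun_prop) _ _)
      (Continuous.intervalIntegrable (by fun_prop) _ _)
      (Continuous.intervalIntegrable (by fun_prop) _ _), smooth3,
      avg.eq_1 k (avg k (avg k f)), avg.eq_1 (k / 3) (avg (k / 3) (avg (k / 3) f)),
      avg.eq_1 (2 * k / 3) (avg (2 * k / 3) (avg (2 * k / 3) f))]
  ring

theorem lintegral_comp_affine_le {c a k : ℝ} (hc : 0 < c)
    (hk : ∀ w ∈ Set.Icc (0 : ℝ) 1, a + c * w ∈ Set.Icc (-k) k) (Φ : ℝ → ℝ≥0∞) :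
    ∫⁻ w in Set.Icc (0 : ℝ) 1, Φ (a + c * w) ≤
      ENNReal.ofReal c⁻¹ * ∫⁻ s in Set.Icc (-k) k, Φ s := by
  have h1 := lintegral_image_eq_lintegral_abs_deriv_mul (s := Set.Icc (0 : ℝ) 1)
    (f := fun w => a + c * w) (f' := fun _ => c) measurableSet_Icc
    (fun w _ => ((((hasDerivAt_id w).const_mul c).const_add a).congr_deriv
      (mul_one c)).hasDerivWithinAt)
    (fun w _ w' _ h => by simpa [hc.ne'] using h) Φ
  have h2 : ∫⁻ w in Set.Icc (0 : ℝ) 1, ENNReal.ofReal |c| * Φ (a + c * w) =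
      ENNReal.ofReal c * ∫⁻ w in Set.Icc (0 : ℝ) 1, Φ (a + c * w) := by
    rw [abs_of_pos hc, lintegral_const_mul' _ _ ENNReal.ofReal_ne_top]
  have h3 : ENNReal.ofReal c * ∫⁻ w in Set.Icc (0 : ℝ) 1, Φ (a + c * w) ≤
      ∫⁻ s in Set.Icc (-k) k, Φ s := by
    rw [← h2, ← h1]
    exact lintegral_mono_set (Set.image_subset_iff.2 hk)
  calc ∫⁻ w in Set.Icc (0 : ℝ) 1, Φ (a + c * w) = ENNReal.ofReal c⁻¹ *
        (ENNReal.ofReal c * ∫⁻ w in Set.Icc (0 : ℝ) 1, Φ (a + c * w)) := by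
        rw [← mul_assoc, ← ENNReal.ofReal_mul (by positivity), inv_mul_cancel₀ hc.ne']
        simp
    _ ≤ _ := by gcongr

theorem enorm_intervalIntegral_le_of_le {φ : ℝ → ℝ} {C : ℝ≥0∞}
    (h : ∀ u ∈ Set.Icc (0 : ℝ) 1, ‖φ u‖ₑ ≤ C) : ‖∫ u in (0 : ℝ)..1, φ u‖ₑ ≤ C := by
  rw [intervalIntegral.integral_of_le zero_le_one]
  calc ‖∫ u in Set.Ioc (0 : ℝ) 1, φ u‖ₑ ≤ ∫⁻ u in Set.Ioc (0 : ℝ) 1, ‖φ u‖ₑ :=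
        enorm_integral_le_lintegral_enorm _
    _ ≤ ∫⁻ _ in Set.Ioc (0 : ℝ) 1, C :=
        setLIntegral_mono measurable_const fun u hu => h u ⟨hu.1.le, hu.2⟩
    _ = C := by simp

/-- The smoothing error is bounded pointwise by an average of third differences over all steps of
size at most `k`: for fixed `u`, `v`, the step `k * ((u + v + w) / 3 - x)` depends on `w` with
constant slope `k / 3`. -/
theorem enorm_sub_smooth3_le (hk : 0 < k) (hk3 : k ≤ 1 / 3) (hf : Integrable f) {x : ℝ}
    (hx : x ∈ Set.Icc (0 : ℝ) 1) :
    ‖f x - smooth3 k f x‖ₑ ≤ ENNReal.ofReal (k / 3)⁻¹ * ∫⁻ s in Set.Icc (-k) k,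
      (diffDomain 3 s).indicator (fun x => ‖diff 3 s f x‖ₑ) x := by
  rw [← enorm_neg, neg_sub, sub_smooth3 hk hf]
  refine enorm_intervalIntegral_le_of_le fun u hu => enorm_intervalIntegral_le_of_le fun v hv => ?_
  have hm : ∀ w ∈ Set.Icc (0 : ℝ) 1, (u + v + w) / 3 ∈ Set.Icc (0 : ℝ) 1 := fun w hw =>
    ⟨by linarith [hu.1, hv.1, hw.1], by linarith [hu.2, hv.2, hw.2]⟩
  have ha : ∀ w : ℝ, k * ((u + v + w) / 3 - x) = k * ((u + v) / 3 - x) + k / 3 * w :=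
    fun w => by ring
  rw [intervalIntegral.integral_of_le zero_le_one, ← integral_Icc_eq_integral_Ioc]
  refine (enorm_integral_le_lintegral_enorm _).trans ?_
  refine le_trans (setLIntegral_mono' measurableSet_Icc fun w hw => ?_)
    (lintegral_comp_affine_le (c := k / 3) (a := k * ((u + v) / 3 - x)) (k := k) (by positivity)
      (fun w hw => ?_) fun s => (diffDomain 3 s).indicator (fun x => ‖diff 3 s f x‖ₑ) x)
  · rw [← ha, Set.indicator_of_mem]
    exact mem_diffDomain_mul_sub hk.le (by push_cast; linarith) hx (hm w hw)
  · rw [← ha]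
    exact abs_le.1 (abs_mul_sub_le hk.le hx (hm w hw))

/-- After Tonelli each step `s` in `[-k, k]` contributes at most `W`, whence the factor
`3 / k * 2 k = 6`. -/
theorem lintegral_sub_smooth3_le (hk : 0 < k) (hk3 : k ≤ 1 / 3) (hf : Integrable f)
    (hfm : Measurable f)
    (hW : ∀ s, |s| ≤ k →
      eLpNorm (diff 3 s f) 1 (volume.restrict (diffDomain 3 s)) ≤ ENNReal.ofReal W) :
    ∫⁻ x in Set.Icc (0 : ℝ) 1, ‖f x - smooth3 k f x‖ₑ ≤ ENNReal.ofReal (6 * W) := by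
  have hdom : MeasurableSet {p : ℝ × ℝ | p.1 ∈ diffDomain 3 p.2} := by
    simp only [mem_diffDomain, Set.mem_Icc]
    measurability
  have hmeas : Measurable (Function.uncurry fun x s : ℝ =>
      (diffDomain 3 s).indicator (fun x => ‖diff 3 s f x‖ₑ) x) := by
    have : Measurable fun p : ℝ × ℝ => ‖diff 3 p.2 f p.1‖ₑ := by
      simp_rw [diff_three]
      fun_prop
    exact this.indicator hdom
  have hdm : ∀ s, MeasurableSet (diffDomain 3 s) := fun s =>
    hdom.preimage (measurable_id.prodMk measurable_const)
  calc ∫⁻ x in Set.Icc (0 : ℝ) 1, ‖f x - smooth3 k f x‖ₑ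
      ≤ ∫⁻ x in Set.Icc (0 : ℝ) 1, ENNReal.ofReal (k / 3)⁻¹ * ∫⁻ s in Set.Icc (-k) k,
          (diffDomain 3 s).indicator (fun x => ‖diff 3 s f x‖ₑ) x :=
        setLIntegral_mono' measurableSet_Icc fun x hx => enorm_sub_smooth3_le hk hk3 hf hx
    _ = ENNReal.ofReal (k / 3)⁻¹ * ∫⁻ s in Set.Icc (-k) k, ∫⁻ x in Set.Icc (0 : ℝ) 1,
          (diffDomain 3 s).indicator (fun x => ‖diff 3 s f x‖ₑ) x := by
        rw [lintegral_const_mul' _ _ ENNReal.ofReal_ne_top,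
          lintegral_lintegral_swap hmeas.aemeasurable]
    _ ≤ ENNReal.ofReal (k / 3)⁻¹ * ∫⁻ _ in Set.Icc (-k) k, ENNReal.ofReal W := by
        refine mul_le_mul' le_rfl ?_
        refine setLIntegral_mono' measurableSet_Icc fun s hs => ?_
        refine le_trans ?_ (hW s (abs_le.2 hs))
        rw [eLpNorm_one_eq_lintegral_enorm, ← lintegral_indicator (hdm s)]
        exact setLIntegral_le_lintegral _ _
    _ = ENNReal.ofReal (6 * W) := by
        rw [setLIntegral_const, Real.volume_Icc, mul_comm (ENNReal.ofReal W), ← mul_assoc,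
          ← ENNReal.ofReal_mul (by positivity), ← ENNReal.ofReal_mul (by
            have : 0 ≤ k - -k := by linarith
            positivity)]
        congr 2
        field_simp
        norm_num

theorem continuous_smooth3 (hk : 0 < k) (hf : Integrable f) : Continuous (smooth3 k f) :=
  continuous_iff_continuousAt.2 fun x => (hasDerivAt_smooth3 hk hf x).continuousAt

theorem integral_abs_sub_smooth3_le (hk : 0 < k) (hk3 : k ≤ 1 / 3) (hf : Integrable f)
    (hfm : Measurable f) (hW0 : 0 ≤ W)
    (hW : ∀ s, |s| ≤ k →
      eLpNorm (diff 3 s f) 1 (volume.restrict (diffDomain 3 s)) ≤ ENNReal.ofReal W) :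
    ∫ x in (0 : ℝ)..1, |f x - smooth3 k f x| ≤ 6 * W := by
  have hm : Measurable (smooth3 k f) := (continuous_smooth3 hk hf).measurable
  rw [intervalIntegral.integral_of_le zero_le_one, ← integral_Icc_eq_integral_Ioc]
  simp_rw [← Real.norm_eq_abs]
  rw [integral_norm_eq_lintegral_enorm (by fun_prop)]
  exact ENNReal.toReal_le_of_le_ofReal (by positivity) (lintegral_sub_smooth3_le hk hk3 hf hfm hW)

/-- The second derivative of the smoothing oscillates by at most a multiple of `k⁻³ W`: the three
averages at scale `j k / 3`, `j = 1, 2, 3`, contribute `3 * 27`, `3 * 27 / 8` and `1`. -/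
theorem c2Bound_smooth3 (hk : 0 < k) (hk3 : k ≤ 1 / 3) (hf : Integrable f)
    (hfm : Measurable f) (hW0 : 0 ≤ W) (hN : ∫ x in (0 : ℝ)..1, |f x| ≤ N)
    (hW : ∀ s, |s| ≤ k →
      eLpNorm (diff 3 s f) 1 (volume.restrict (diffDomain 3 s)) ≤ ENNReal.ofReal W) :
    C2Bound (smooth3 k f) (smooth3Deriv k f) (smooth3Deriv2 k f)
      (130000 * (N + k⁻¹ ^ 3 * W)) := by
  have hN0 : 0 ≤ N :=
    (intervalIntegral.integral_nonneg zero_le_one fun x _ => abs_nonneg (f x)).trans hN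
  have hk1 : 1 ≤ k⁻¹ ^ 3 := one_le_pow₀ ((one_le_inv₀ hk).2 (by linarith))
  have hWk : W ≤ k⁻¹ ^ 3 * W := le_mul_of_one_le_left hW0 hk1
  have hgc := continuous_smooth3 hk hf
  have h := C2Bound.of_oscillation_deriv2 (N := N + 6 * W) (B := 93 * (k⁻¹ ^ 3 * W))
    (hasDerivAt_smooth3 hk hf) (hasDerivAt_smooth3Deriv hk hf)
    (by
      have i1 : IntervalIntegrable f volume 0 1 := hf.intervalIntegrable
      have i2 : IntervalIntegrable (smooth3 k f) volume 0 1 := hgc.intervalIntegrable _ _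
      calc ∫ x in (0 : ℝ)..1, |smooth3 k f x|
          ≤ ∫ x in (0 : ℝ)..1, (|f x| + |f x - smooth3 k f x|) := by
            refine intervalIntegral.integral_mono_on zero_le_one i2.abs
              (i1.abs.add (i1.sub i2).abs) fun x _ => ?_
            have := abs_sub (f x) (f x - smooth3 k f x)
            rwa [sub_sub_cancel] at this
        _ = (∫ x in (0 : ℝ)..1, |f x|) + ∫ x in (0 : ℝ)..1, |f x - smooth3 k f x| :=
            intervalIntegral.integral_add i1.abs (i1.sub i2).abs
        _ ≤ N + 6 * W := add_le_add hN (integral_abs_sub_smooth3_le hk hk3 hf hfm hW0 hW))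
    (fun x hx => by
      have small : ∀ {u v : ℝ}, |u| ≤ 1 → |u * v| ≤ |v| := fun {u v} hu => by
        rw [abs_mul]; exact mul_le_of_le_one_left (abs_nonneg _) hu
      have key : ∀ {c : ℝ}, 0 ≤ 1 - 3 * c → 0 < c → c ≤ k →
          |(1 - 3 * c) * ((1 - 3 * c) * avg3Deriv2 c f ((1 - 3 * c) * x))
            - (1 - 3 * c) * ((1 - 3 * c) * avg3Deriv2 c f ((1 - 3 * c) * 0))| ≤ c⁻¹ ^ 3 * W := by
        intro c h1 hc hck
        have b1 : |1 - 3 * c| ≤ 1 := abs_le.2 ⟨by linarith, by linarith⟩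
        rw [← mul_sub, ← mul_sub]
        refine (small b1).trans ((small b1).trans ?_)
        rw [mul_zero]
        refine abs_avg3Deriv2_sub_le hc hf hW0 (hW c (by rwa [abs_of_pos hc])) le_rfl
          (mul_nonneg h1 hx.1) ?_
        linarith [mul_le_of_le_one_right h1 hx.2]
      have k1 := key (c := k / 3) (by linarith) (by linarith) (by linarith)
      have k2 := key (c := 2 * k / 3) (by linarith) (by linarith) (by linarith)
      have k3 := key (c := k) (by linarith) hk le_rfl
      rw [show 1 - 3 * (k / 3) = 1 - k by ring,
        show (k / 3)⁻¹ ^ 3 * W = 27 * (k⁻¹ ^ 3 * W) by rw [inv_div, div_eq_mul_inv]; ring] at k1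
      rw [show 1 - 3 * (2 * k / 3) = 1 - 2 * k by ring,
        show (2 * k / 3)⁻¹ ^ 3 * W = 27 / 8 * (k⁻¹ ^ 3 * W) by
          rw [inv_div, div_eq_mul_inv, mul_inv]; ring] at k2
      have l1 := abs_le.1 k1
      have l2 := abs_le.1 k2
      have l3 := abs_le.1 k3
      have hpos : 0 ≤ k⁻¹ ^ 3 * W := by positivity
      rw [smooth3Deriv2, smooth3Deriv2]
      exact abs_le.2 ⟨by linarith, by linarith⟩)
  exact ⟨h.deriv1, h.deriv2, fun x hx => (h.bound0 x hx).trans (by linarith),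
    fun x hx => (h.bound1 x hx).trans (by linarith),
    fun x hx => (h.bound2 x hx).trans (by linarith)⟩

end Integrable

/-! ### Moduli of smoothness -/

theorem modulus_nonneg (r : ℕ) (p : ℝ≥0∞) (f : ℝ → ℝ) (δ : ℝ) : 0 ≤ modulus r p f δ :=
  ENNReal.toReal_nonneg

/-- The uniform bound `B` makes the supremum in the modulus finite, so that `toReal` in its
definition loses nothing. -/
theorem eLpNorm_diff_le_modulus {r : ℕ} {p : ℝ≥0∞} {f : ℝ → ℝ} {δ : ℝ} {B : ℝ≥0∞} (hB : B ≠ ∞)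
    (hf : ∀ h, eLpNorm (diff r h f) p (volume.restrict (diffDomain r h)) ≤ B) {h : ℝ}
    (hh : |h| ≤ δ) : eLpNorm (diff r h f) p (volume.restrict (diffDomain r h)) ≤
      ENNReal.ofReal (modulus r p f δ) := by
  rw [modulus, ENNReal.ofReal_toReal (ne_top_of_le_ne_top hB (iSup₂_le fun h _ => hf h))]
  exact le_iSup₂ (f := fun (h : ℝ) (_ : |h| ≤ δ) =>
    eLpNorm (diff r h f) p (volume.restrict (diffDomain r h))) h hh

theorem continuous_diff {f : ℝ → ℝ} (hf : Continuous f) (r : ℕ) (h : ℝ) :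
    Continuous (diff r h f) := by
  unfold diff
  fun_prop

theorem diffDomain_two (h : ℝ) :
    diffDomain 2 h = Set.Icc (max 0 (-(2 * h))) (min 1 (1 - 2 * h)) := by
  ext x
  simp only [mem_diffDomain, Set.mem_Icc, max_le_iff, le_min_iff, Nat.cast_ofNat]
  constructor
  · rintro ⟨⟨h1, h2⟩, h3, h4⟩
    exact ⟨⟨h1, by linarith⟩, h2, by linarith⟩
  · rintro ⟨⟨h1, h2⟩, h3, h4⟩
    exact ⟨⟨h1, h3⟩, by linarith, by linarith⟩

/-- For continuous `f` the essential supremum in the modulus bounds every second difference.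
The step is less than `1/2`, so that `diffDomain 2 s` is a nondegenerate interval. -/
theorem abs_diff_le_modulusC (f : C01) {δ s x : ℝ} (hδ : δ < 1 / 2) (hs : |s| ≤ δ)
    (hx : x ∈ diffDomain 2 s) :
    |diff 2 s (Set.IccExtend zero_le_one f) x| ≤ modulusC 2 f δ := by
  have hfc : Continuous (Set.IccExtend (zero_le_one' ℝ) f) := f.continuous.Icc_extend'
  have hfb : ∀ y, |Set.IccExtend (zero_le_one' ℝ) f y| ≤ ‖f‖ := fun y => f.norm_coe_le_norm _
  have h1 : eLpNorm (diff 2 s (Set.IccExtend zero_le_one f)) ∞ (volume.restrict (diffDomain 2 s))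
      ≤ ENNReal.ofReal (modulusC 2 f δ) := by
    refine eLpNorm_diff_le_modulus (B := ENNReal.ofReal (4 * ‖f‖)) ENNReal.ofReal_ne_top
      (fun h => ?_) hs
    rw [eLpNorm_exponent_top]
    refine eLpNormEssSup_le_of_ae_bound (Filter.Eventually.of_forall fun y => ?_)
    rw [diff_two, Real.norm_eq_abs]
    have i1 := abs_le.1 (hfb (y + 2 * h))
    have i2 := abs_le.1 (hfb (y + h))
    have i3 := abs_le.1 (hfb y)
    exact abs_le.2 ⟨by linarith, by linarith⟩
  set D := diff 2 s (Set.IccExtend zero_le_one f) with hD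
  have hDc : Continuous D := continuous_diff hfc 2 s
  set W := modulusC 2 f δ with hW
  have hW0 : 0 ≤ W := modulus_nonneg _ _ _ _
  have h2 : ∀ᵐ y ∂volume.restrict (diffDomain 2 s), |D y| ≤ W := by
    rw [eLpNorm_exponent_top] at h1
    filter_upwards [ae_le_eLpNormEssSup (f := D) (μ := volume.restrict (diffDomain 2 s))]
      with y hy
    have := hy.trans h1
    rwa [← ofReal_norm, ENNReal.ofReal_le_ofReal_iff hW0] at this
  rw [diffDomain_two] at hx h2
  have hne : max 0 (-(2 * s)) ≠ min 1 (1 - 2 * s) := by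
    have i := abs_lt.1 (hs.trans_lt hδ)
    refine ne_of_lt (max_lt (lt_min ?_ ?_) (lt_min ?_ ?_)) <;> linarith [i.1, i.2]
  -- The continuous functions `min |D y| W` and `|D y|` agree almost everywhere on an interval.
  have h3 := Measure.eqOn_Icc_of_ae_eq volume hne (f := fun y => min |D y| W)
    (g := fun y => |D y|) (h2.mono fun y hy => min_eq_left hy)
    (by fun_prop) (by fun_prop) hx
  exact min_eq_left_iff.1 h3

theorem eLpNorm_diff_le {f : ℝ → ℝ} (hf : AEStronglyMeasurable f volume) (r : ℕ) (h : ℝ) :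
    eLpNorm (diff r h f) 1 volume ≤
      ∑ j ∈ Finset.range (r + 1), ‖(-1 : ℝ) ^ j * (r.choose j : ℝ)‖ₑ * eLpNorm f 1 volume := by
  have hq : ∀ c : ℝ, MeasurePreserving (fun x : ℝ => x + c) volume volume :=
    fun c => measurePreserving_add_right volume c
  have e : diff r h f = ∑ j ∈ Finset.range (r + 1),
      ((-1 : ℝ) ^ j * (r.choose j : ℝ)) • (f ∘ fun x => x + ((r : ℝ) - (j : ℝ)) * h) := by
    ext x
    simp [diff]
  rw [e]
  refine (eLpNorm_sum_le (fun j _ => (hf.comp_measurePreserving (hq _)).const_smul _)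
    le_rfl).trans (Finset.sum_le_sum fun j _ => ?_)
  rw [eLpNorm_const_smul, eLpNorm_comp_measurePreserving hf (hq _)]

theorem diff_three_congr {f g : ℝ → ℝ} (hfg : ∀ x ∈ Set.Icc (0 : ℝ) 1, f x = g x) {h x : ℝ}
    (hx : x ∈ diffDomain 3 h) : diff 3 h f x = diff 3 h g x := by
  obtain ⟨⟨h1, h2⟩, h3, h4⟩ := hx
  push_cast at h3 h4
  rw [diff_three, diff_three, hfg x ⟨h1, h2⟩, hfg _ ⟨h3, h4⟩, hfg (x + h), hfg (x + 2 * h)]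
  · exact ⟨by linarith, by linarith⟩
  · exact ⟨by linarith, by linarith⟩

/-- The extension by zero of `f ∈ L₁([0,1])` to the line. -/
noncomputable def extendL1 (f : L1) : ℝ → ℝ := (Set.Icc (0 : ℝ) 1).indicator f

theorem extendL1_of_mem (f : L1) {x : ℝ} (hx : x ∈ Set.Icc (0 : ℝ) 1) : extendL1 f x = f x :=
  Set.indicator_of_mem hx _

theorem measurable_extendL1 (f : L1) : Measurable (extendL1 f) :=
  (Lp.stronglyMeasurable f).measurable.indicator measurableSet_Icc

theorem integrable_extendL1 (f : L1) : Integrable (extendL1 f) :=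
  (integrable_indicator_iff measurableSet_Icc).2 (L1.integrable_coeFn f)

theorem integral_abs_extendL1 (f : L1) : ∫ x in (0 : ℝ)..1, |extendL1 f x| = ‖f‖ := by
  rw [intervalIntegral.integral_of_le zero_le_one, ← integral_Icc_eq_integral_Ioc,
    L1.norm_eq_integral_norm]
  exact setIntegral_congr_fun measurableSet_Icc fun x hx => by
    simp [extendL1_of_mem f hx]

theorem eLpNorm_diff_extendL1_le (f : L1) {δ s : ℝ} (hs : |s| ≤ δ) :
    eLpNorm (diff 3 s (extendL1 f)) 1 (volume.restrict (diffDomain 3 s)) ≤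
      ENNReal.ofReal (modulusL1 3 f δ) := by
  have hdm : ∀ s, MeasurableSet (diffDomain 3 s) := fun s => by
    simp only [diffDomain]
    measurability
  have e : ∀ s, eLpNorm (diff 3 s (extendL1 f)) 1 (volume.restrict (diffDomain 3 s)) =
      eLpNorm (diff 3 s f) 1 (volume.restrict (diffDomain 3 s)) := fun s =>
    eLpNorm_congr_ae ((ae_restrict_mem (hdm s)).mono fun x hx =>
      diff_three_congr (fun y hy => extendL1_of_mem f hy) hx)
  rw [e]
  refine eLpNorm_diff_le_modulus (B := ∑ j ∈ Finset.range (3 + 1),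
    ‖(-1 : ℝ) ^ j * (Nat.choose 3 j : ℝ)‖ₑ * eLpNorm (extendL1 f) 1 volume) ?_ (fun h => ?_) hs
  · exact ENNReal.sum_ne_top.2 fun j _ => ENNReal.mul_ne_top enorm_ne_top
      (memLp_one_iff_integrable.2 (integrable_extendL1 f)).eLpNorm_ne_top
  · rw [← e]
    exact (eLpNorm_mono_measure _ Measure.restrict_le_self).trans
      (eLpNorm_diff_le (integrable_extendL1 f).aestronglyMeasurable 3 h)

/-! ### Density of polynomials -/

theorem exists_c2Bound_polynomial (p : Polynomial ℝ) : ∃ D, C2Bound (fun x => p.eval x)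
    (fun x => p.derivative.eval x) (fun x => p.derivative.derivative.eval x) D := by
  have key : ∀ q : Polynomial ℝ, ∃ D, ∀ x ∈ Set.Icc (0 : ℝ) 1, |q.eval x| ≤ D := fun q => by
    obtain ⟨D, hD⟩ := isCompact_Icc.exists_bound_of_continuousOn (s := Set.Icc (0 : ℝ) 1)
      q.continuous.continuousOn
    exact ⟨D, hD⟩
  obtain ⟨D₀, h₀⟩ := key p
  obtain ⟨D₁, h₁⟩ := key p.derivative
  obtain ⟨D₂, h₂⟩ := key p.derivative.derivative
  exact ⟨max D₀ (max D₁ D₂), fun x => p.hasDerivAt x, fun x => p.derivative.hasDerivAt x,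
    fun x hx => (h₀ x hx).trans (le_max_left _ _),
    fun x hx => (h₁ x hx).trans ((le_max_left _ _).trans (le_max_right _ _)),
    fun x hx => (h₂ x hx).trans ((le_max_right _ _).trans (le_max_right _ _))⟩

theorem exists_polynomial_near_C01 (f : C01) {ε : ℝ} (hε : 0 < ε) :
    ∃ (p : Polynomial ℝ) (G : C01), (∀ x, G x = p.eval (x : ℝ)) ∧ ‖f - G‖ ≤ ε := by
  obtain ⟨p, hp⟩ := exists_polynomial_near_of_continuousOn 0 1 (Set.IccExtend zero_le_one f)
    f.continuous.Icc_extend'.continuousOn ε hε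
  refine ⟨p, ⟨fun x => p.eval (x : ℝ), by fun_prop⟩, fun x => rfl,
    (ContinuousMap.norm_le _ hε.le).2 fun x => ?_⟩
  have := (hp x x.2).le
  rw [Set.IccExtend_val, abs_sub_comm] at this
  exact this

theorem memLp_of_continuous {g : ℝ → ℝ} (hg : Continuous g) : MemLp g 1 vol01 :=
  memLp_one_iff_integrable.2 hg.continuousOn.integrableOn_Icc

theorem exists_polynomial_near_L1 (f : L1) {ε : ℝ} (hε : 0 < ε) :
    ∃ (p : Polynomial ℝ) (G : L1), (∀ᵐ x ∂vol01, G x = p.eval x) ∧ ‖f - G‖ ≤ ε := by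
  have hε2 : 0 < ε / 2 := by positivity
  obtain ⟨g, hg, hgm⟩ := (Lp.memLp f).exists_boundedContinuous_eLpNorm_sub_le ENNReal.one_ne_top
    (ε := ENNReal.ofReal (ε / 2)) (by simpa using hε)
  obtain ⟨p, hp⟩ := exists_polynomial_near_of_continuousOn 0 1 g g.continuous.continuousOn
    (ε / 2) hε2
  have hpm : MemLp (fun x => p.eval x) 1 vol01 := memLp_of_continuous p.continuous
  refine ⟨p, hpm.toLp _, hpm.coeFn_toLp, ?_⟩
  have h1 : eLpNorm (⇑g - fun x => p.eval x) 1 vol01 ≤ ENNReal.ofReal (ε / 2) := by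
    refine (eLpNorm_le_of_ae_bound (C := ε / 2) ((ae_restrict_mem measurableSet_Icc).mono
      fun x hx => ?_)).trans ?_
    · have := (hp x hx).le
      rwa [abs_sub_comm] at this
    · simp
  rw [Lp.norm_def]
  refine ENNReal.toReal_le_of_le_ofReal hε.le ?_
  have h2 : ⇑(f - hpm.toLp _) =ᵐ[vol01] (⇑f - ⇑g) + (⇑g - fun x => p.eval x) := by
    filter_upwards [Lp.coeFn_sub f (hpm.toLp _), hpm.coeFn_toLp] with x h3 h4
    rw [h3, Pi.sub_apply, h4]
    simp
  rw [eLpNorm_congr_ae h2]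
  calc _ ≤ eLpNorm (⇑f - ⇑g) 1 vol01 + eLpNorm (⇑g - fun x => p.eval x) 1 vol01 :=
        eLpNorm_add_le ((Lp.memLp f).sub hgm).1 (hgm.sub hpm).1 le_rfl
    _ ≤ ENNReal.ofReal (ε / 2) + ENNReal.ofReal (ε / 2) := add_le_add hg h1
    _ = ENNReal.ofReal ε := by rw [← ENNReal.ofReal_add hε2.le hε2.le, add_halves]

/-! ### The error estimate -/

/-- Three ranges of the test error `l`: for `l = 0` the operator fixes a dense set; for large `l`
the trivial bound `(1 + ‖T‖) ‖f‖` suffices; otherwise `f` is smoothed with step `l ^ (1 / r)`. -/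
theorem IsSublinear.norm_sub_apply_le_of_smoothing {E : Type*} [NormedAddCommGroup E]
    [NormedSpace ℝ E] [Lattice E] [IsOrderedAddMonoid E] [HasSolidNorm E] [PosSMulMono ℝ E]
    [CompleteSpace E] {T : E → E} (hT : IsSublinear T) (hm : Monotone T) {r : ℕ} (hr : 0 < r)
    {K l w : ℝ} (hK : 0 ≤ K) (hl : 0 ≤ l) (hw : 0 ≤ w) {f : E}
    (hdense : l = 0 → ∀ ε > 0, ∃ G, ‖f - G‖ ≤ ε ∧ ‖T G - G‖ ≤ 0)
    (hsmooth : 0 < l ^ (1 / r : ℝ) → l ^ (1 / r : ℝ) < 1 / r → ∃ G, ‖f - G‖ ≤ K * w ∧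
      ‖T G - G‖ ≤ K * (‖f‖ + (l ^ (1 / r : ℝ))⁻¹ ^ r * w) * l) :
    ‖f - T f‖ ≤ ((r : ℝ) ^ r + 2 * K) * (1 + |opNorm T|) * (‖f‖ * l + w) := by
  have hM := opNorm_nonneg T
  rw [abs_of_nonneg hM]
  have hpow : (l ^ (1 / r : ℝ)) ^ r = l := by
    rw [one_div, Real.rpow_inv_natCast_pow hl hr.ne']
  have hr1 : (0 : ℝ) < r := by exact_mod_cast hr
  have hfl : 0 ≤ ‖f‖ * l := by positivity
  set M := opNorm T with hMdef
  rcases hl.eq_or_lt with h0 | hpos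
  · have hle : ‖f - T f‖ ≤ 0 := by
      refine le_of_forall_pos_le_add fun ε hε => ?_
      obtain ⟨G, hG, hTG⟩ := hdense h0.symm (ε / (1 + M)) (by positivity)
      calc ‖f - T f‖ ≤ (1 + M) * ‖f - G‖ + ‖T G - G‖ := hT.norm_sub_apply_le hm f G
        _ ≤ (1 + M) * (ε / (1 + M)) + 0 := by gcongr
        _ = 0 + ε := by field_simp; ring
    exact hle.trans (by positivity)
  rcases le_or_gt (1 / r : ℝ) (l ^ (1 / r : ℝ)) with hbig | hsmall
  · have hl1 : 1 ≤ (r : ℝ) ^ r * l := by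
      rw [← hpow, ← mul_pow]
      exact one_le_pow₀ ((div_le_iff₀' hr1).1 hbig)
    calc ‖f - T f‖ ≤ ‖f‖ + M * ‖f‖ :=
          (_root_.norm_sub_le _ _).trans (by gcongr; exact hT.norm_le_opNorm hm f)
      _ = (1 + M) * ‖f‖ * 1 := by ring
      _ ≤ (1 + M) * ‖f‖ * ((r : ℝ) ^ r * l) := by gcongr
      _ = ((r : ℝ) ^ r + 0) * (1 + M) * (‖f‖ * l + 0) := by ring
      _ ≤ _ := by gcongr; positivity
  · obtain ⟨G, hG, hTG⟩ := hsmooth (Real.rpow_pos_of_pos hpos _) hsmall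
    have hcancel : (l ^ (1 / r : ℝ))⁻¹ ^ r * w * l = w := by
      rw [inv_pow, hpow]; field_simp
    have hrr : (0 : ℝ) ≤ (r : ℝ) ^ r := by positivity
    calc ‖f - T f‖ ≤ (1 + M) * ‖f - G‖ + ‖T G - G‖ := hT.norm_sub_apply_le hm f G
      _ ≤ (1 + M) * (K * w) + K * (‖f‖ + (l ^ (1 / r : ℝ))⁻¹ ^ r * w) * l := by gcongr
      _ = (1 + M) * (K * w) + 1 * (K * (‖f‖ * l + w)) := by
          linear_combination K * hcancel
      _ ≤ (1 + M) * (K * (‖f‖ * l + w)) + (1 + M) * (K * (‖f‖ * l + w)) := by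
          gcongr <;> linarith
      _ = (0 + 2 * K) * (1 + M) * (‖f‖ * l + w) := by ring
      _ ≤ _ := by gcongr

theorem norm_sub_apply_le_C01 {T : C01 → C01} (hT : IsSublinear T) (hm : Monotone T)
    (ht : IsStronglyTranslatable (monoC 0) T) (f : C01) :
    ‖f - T f‖ ≤ 484 * (1 + |opNorm T|) *
      (‖f‖ * testError monoC T + modulusC 2 f (testError monoC T ^ (1 / 2 : ℝ))) := by
  refine (hT.norm_sub_apply_le_of_smoothing hm (r := 2) (K := 240) (l := testError monoC T)
    (w := modulusC 2 f (testError monoC T ^ (1 / 2 : ℝ))) two_pos (by norm_num)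
    (testError_nonneg _ _) (modulus_nonneg _ _ _ _) (fun hl ε hε => ?_)
    (fun hpos hlt => ?_)).trans_eq (by norm_num)
  · obtain ⟨p, G, hG, hfG⟩ := exists_polynomial_near_C01 f hε
    obtain ⟨D, hD⟩ := exists_c2Bound_polynomial p
    exact ⟨G, hfG, (hD.norm_apply_sub_le_C01 hT hm ht hG).trans (by rw [hl, mul_zero])⟩
  · push_cast at hpos hlt ⊢
    set k := testError monoC T ^ (1 / 2 : ℝ) with hk
    have hfc : Continuous (Set.IccExtend (zero_le_one' ℝ) f) := f.continuous.Icc_extend'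
    have hW : ∀ s x, |s| ≤ k → x ∈ diffDomain 2 s →
        |diff 2 s (Set.IccExtend zero_le_one f) x| ≤ modulusC 2 f k :=
      fun s x hs hx => abs_diff_le_modulusC f hlt hs hx
    have hb := c2Bound_smooth2 hpos hlt.le hfc (fun x _ => f.norm_coe_le_norm _) hW
    set G : C01 := ⟨fun x => smooth2 k (Set.IccExtend zero_le_one f) x,
      hb.continuous.comp continuous_subtype_val⟩ with hG
    have hW0 : 0 ≤ modulusC 2 f k := modulus_nonneg _ _ _ _
    refine ⟨G, (ContinuousMap.norm_le _ (by positivity)).2 fun x => ?_, ?_⟩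
    · have h1 := abs_sub_smooth2_le hpos hlt.le hfc hW x.2
      rw [Set.IccExtend_val] at h1
      exact h1.trans (by linarith)
    · refine (hb.norm_apply_sub_le_C01 hT hm ht (G := G) fun x => rfl).trans_eq ?_
      ring

theorem norm_sub_apply_le_L1 {T : L1 → L1} (hT : IsSublinear T) (hm : Monotone T)
    (ht : IsStronglyTranslatable (monoL1 0) T) (f : L1) :
    ‖f - T f‖ ≤ 3120027 * (1 + |opNorm T|) *
      (‖f‖ * testError monoL1 T + modulusL1 3 f (testError monoL1 T ^ (1 / 3 : ℝ))) := by
  refine (hT.norm_sub_apply_le_of_smoothing hm (r := 3) (K := 1560000) (l := testError monoL1 T)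
    (w := modulusL1 3 f (testError monoL1 T ^ (1 / 3 : ℝ))) three_pos (by norm_num)
    (testError_nonneg _ _) (modulus_nonneg _ _ _ _) (fun hl ε hε => ?_)
    (fun hpos hlt => ?_)).trans_eq (by norm_num)
  · obtain ⟨p, G, hG, hfG⟩ := exists_polynomial_near_L1 f hε
    obtain ⟨D, hD⟩ := exists_c2Bound_polynomial p
    exact ⟨G, hfG, (hD.norm_apply_sub_le_L1 hT hm ht hG).trans (by rw [hl, mul_zero])⟩
  · push_cast at hpos hlt ⊢
    set k := testError monoL1 T ^ (1 / 3 : ℝ) with hk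
    have hi := integrable_extendL1 f
    have hW : ∀ s, |s| ≤ k → eLpNorm (diff 3 s (extendL1 f)) 1
        (volume.restrict (diffDomain 3 s)) ≤ ENNReal.ofReal (modulusL1 3 f k) :=
      fun s hs => eLpNorm_diff_extendL1_le f hs
    have hW0 : 0 ≤ modulusL1 3 f k := modulus_nonneg _ _ _ _
    have hb := c2Bound_smooth3 hpos hlt.le hi (measurable_extendL1 f) hW0
      (integral_abs_extendL1 f).le hW
    have hgm := memLp_of_continuous hb.continuous
    refine ⟨hgm.toLp _, ?_, ?_⟩
    · have h1 := integral_abs_sub_smooth3_le hpos hlt.le hi (measurable_extendL1 f) hW0 hW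
      rw [intervalIntegral.integral_of_le zero_le_one, ← integral_Icc_eq_integral_Ioc] at h1
      rw [L1.norm_eq_integral_norm]
      refine le_trans (le_of_eq (integral_congr_ae ?_)) (h1.trans (by linarith))
      filter_upwards [Lp.coeFn_sub f (hgm.toLp _), hgm.coeFn_toLp,
        ae_restrict_mem measurableSet_Icc] with x h2 h3 hx
      rw [h2, Pi.sub_apply, h3, extendL1_of_mem f hx, Real.norm_eq_abs]
    · refine (hb.norm_apply_sub_le_L1 hT hm ht hgm.coeFn_toLp).trans_eq ?_
      ring

end Korovkin

theorem mainTheorem2 :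
    (∃ C : ℝ → ℝ, (∀ M : ℝ, 0 < C M) ∧
      ∀ T : Korovkin.C01 → Korovkin.C01,
        Korovkin.IsSublinear T → Monotone T →
        Korovkin.IsStronglyTranslatable (Korovkin.monoC 0) T →
        ∀ f : Korovkin.C01,
          ‖f - T f‖ ≤ C (Korovkin.opNorm T) *
            (‖f‖ * Korovkin.testError Korovkin.monoC T +
              Korovkin.modulusC 2 f (Korovkin.testError Korovkin.monoC T ^ (1 / 2 : ℝ)))) ∧
    (∃ C : ℝ → ℝ, (∀ M : ℝ, 0 < C M) ∧
      ∀ T : Korovkin.L1 → Korovkin.L1,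
        Korovkin.IsSublinear T → Monotone T →
        Korovkin.IsStronglyTranslatable (Korovkin.monoL1 0) T →
        ∀ f : Korovkin.L1,
          ‖f - T f‖ ≤ C (Korovkin.opNorm T) *
            (‖f‖ * Korovkin.testError Korovkin.monoL1 T +
              Korovkin.modulusL1 3 f (Korovkin.testError Korovkin.monoL1 T ^ (1 / 3 : ℝ)))) := by
  refine ⟨⟨fun M => 484 * (1 + |M|), fun M => by positivity,
    fun T hT hm ht f => Korovkin.norm_sub_apply_le_C01 hT hm ht f⟩,
    ⟨fun M => 3120027 * (1 + |M|), fun M => by positivity,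
    fun T hT hm ht f => Korovkin.norm_sub_apply_le_L1 hT hm ht f⟩⟩
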